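/- Let $d,m\in\mathbb N$, let $\Omega\subset\mathbb R^d$ be a bounded open set, and let $B_1,\dots,B_m\subset\Omega$ be nonempty open sets. Assume that there are bounded convex sets $K_1,\dots,K_m\subset\mathbb R^d$ with $B_i\subset K_i$ for all $i$ and $\Omega\subset\bigcup_{i=1}^m\overline{K_i}$. Put $$M=\max_{x\in\Omega}\,|\{i : x\in K_i\}|,\qquad R=\max_i \operatorname{diam}(K_i),\qquad \eta=\begin{cases}1 & \text{if } B_i=K_i \text{ for all } i,\\ 3\max_i |K_i|/|B_i| & \text{otherwise.}\end{cases}$$ Write $\langle v\rangle_{B}=|B|^{-1}\int_B v\,dx$. For $w,v\in L^2(\Omega)$ and given data $b_1,\dots,b_m\in\mathbb R$ let $$b(w,v)=\sum_{i=1}^m|B_i|\,\langle w\rangle_{B_i}\,\langle v\rangle_{B_i},\qquad \widetilde{b(u,v)}=\sum_{i=1}^m b_i\,|B_i|\,\langle v\rangle_{B_i} ,$$ and for $w,v\in H^1(\Omega)$ let $\tilde a(w,v)=\int_\Omega\tilde\alpha\,\nabla w\cdot\nabla v+\tilde\sigma\, w v\,dx$ and $\tilde\ell(v)=\int_\Omega\tilde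 f v\,dx$. Let $\delta>0$ and $\theta\in(0,1]$ satisfy $$\theta\,\frac{R^2M}{\pi^2}\le\delta\le\theta^{-1}\,\frac{R^2M}{\pi^2}.$$ Let $V\subset H^1_0(\Omega)$ be a linear subspace (for instance $V=H^1_0(\Omega)$) and let $u\in V\cap H^2(\Omega)$. Let $\tilde u\in V$ be a solution of the regularized problem $$\tilde a(\tilde u,v)+\delta^{-1}b(\tilde u,v)=\tilde\ell(v)+\delta^{-1}\,\widetilde{b(u,v)}\qquad\text{for all } v\in V$$ with $\tilde\alpha=1$, $\tilde\sigma=0$ and $\tilde f=0$, so that $\tilde a(w,v)=\int_\Omega\nabla w\cdot\nabla v\,dx$ and $\tilde\ell=0$. Then $$\|\tilde u-u\|_{L^2(\Omega)}\le\eta\,\theta^{-1}\,\frac{R^2M}{\pi^2}\,\|\Delta u\|_{L^2(\Omega)}+\eta\,\theta^{-1}\,\bigl\|\widetilde{b(u,\cdot)}-b(u,\cdot)\bigr\|_{L^2(\Omega)},$$ where the last norm is the $L^2(\Omega)$-norm of the Riesz representative of the functional, i.e. its operator norm on $L^2(\Omega)$. -/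

import Mathlib

open MeasureTheory

open scoped ContDiff

noncomputable section

/-- The Lebesgue space `L²(Ω)` of real functions on `Ω ⊆ ℝᵈ`. -/
abbrev L2 {d : ℕ} (Ω : Set (EuclideanSpace ℝ (Fin d))) : Type :=
  Lp ℝ 2 (volume.restrict Ω)

/-! ### Sobolev spaces -/

/-- `φ ∈ C_c^∞(Ω)`. -/
structure IsTestFunction {d : ℕ} (Ω : Set (EuclideanSpace ℝ (Fin d)))
    (φ : EuclideanSpace ℝ (Fin d) → ℝ) : Prop where
  smooth : ContDiff ℝ ∞ φ
  compact : HasCompactSupport φ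
  support : tsupport φ ⊆ Ω

/-- `g ∈ L²(Ω)` is the weak `i`-th partial derivative of `u ∈ L²(Ω)`. -/
def HasWeakPartial {d : ℕ} {Ω : Set (EuclideanSpace ℝ (Fin d))}
    (i : Fin d) (u g : L2 Ω) : Prop :=
  ∀ φ : EuclideanSpace ℝ (Fin d) → ℝ, IsTestFunction Ω φ →
    ∫ x in Ω, u x * fderiv ℝ φ x (EuclideanSpace.single i 1) = -∫ x in Ω, g x * φ x

/-- On an open set a weak partial derivative is unique, so that choosing one is harmless. -/
theorem HasWeakPartial.unique {d : ℕ} {Ω : Set (EuclideanSpace ℝ (Fin d))} (hΩ : IsOpen Ω)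
    {i : Fin d} {u g h : L2 Ω} (hg : HasWeakPartial i u g) (hh : HasWeakPartial i u h) :
    g = h := by
  have hint : ∀ (v : L2 Ω) (φ : EuclideanSpace ℝ (Fin d) → ℝ), IsTestFunction Ω φ →
      IntegrableOn (fun x => v x * φ x) Ω := fun v φ hφ =>
    MemLp.integrable_mul (p := 2) (q := 2) (Lp.memLp v)
      ((hφ.smooth.continuous.memLp_of_hasCompactSupport hφ.compact).restrict Ω)
  have key : ∀ᵐ x ∂volume, x ∈ Ω → g x - h x = 0 := by
    refine hΩ.ae_eq_zero_of_integral_contDiff_smul_eq_zero ?_ ?_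
    · exact locallyIntegrableOn_of_locallyIntegrable_restrict
        (((Lp.memLp g).sub (Lp.memLp h)).locallyIntegrable (by norm_num))
    · intro φ h1 h2 h3
      have hφ : IsTestFunction Ω φ := ⟨h1, h2, h3⟩
      have hsupp : ∫ x, φ x • (g x - h x) = ∫ x in Ω, φ x • (g x - h x) := by
        refine (setIntegral_eq_integral_of_forall_compl_eq_zero fun x hx => ?_).symm
        rw [image_eq_zero_of_notMem_tsupport (fun hx' => hx (h3 hx')), zero_smul]
      have hsub : ∫ x in Ω, φ x • (g x - h x) = ∫ x in Ω, (g x * φ x - h x * φ x) := by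
        congr 1; ext x; simp only [smul_eq_mul]; ring
      rw [hsupp, hsub, integral_sub (hint g φ hφ) (hint h φ hφ)]
      have e1 := hg φ hφ
      have e2 := hh φ hφ
      linarith
  refine Lp.ext ((ae_restrict_iff' hΩ.measurableSet).2 ?_)
  filter_upwards [key] with x hx hxΩ using sub_eq_zero.1 (hx hxΩ)

/-- The weak partial derivative `∂ᵢ u` (zero if there is none in `L²(Ω)`). -/
def weakPartial {d : ℕ} {Ω : Set (EuclideanSpace ℝ (Fin d))} (i : Fin d) (u : L2 Ω) : L2 Ω :=
  open Classical in if h : ∃ g, HasWeakPartial i u g then h.choose else 0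

/-- The Sobolev space `H¹(Ω)`. -/
def H1 {d : ℕ} (Ω : Set (EuclideanSpace ℝ (Fin d))) : Set (L2 Ω) :=
  {u | ∀ i, ∃ g, HasWeakPartial i u g}

/-- The Sobolev space `H²(Ω)`. -/
def H2 {d : ℕ} (Ω : Set (EuclideanSpace ℝ (Fin d))) : Set (L2 Ω) :=
  {u | u ∈ H1 Ω ∧ ∀ i, weakPartial i u ∈ H1 Ω}

/-- The `H¹(Ω)`-norm. -/
def H1norm {d : ℕ} {Ω : Set (EuclideanSpace ℝ (Fin d))} (u : L2 Ω) : ℝ :=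
  Real.sqrt (‖u‖ ^ 2 + ∑ i, ‖weakPartial i u‖ ^ 2)

/-- The space `H¹₀(Ω)`: the closure of `C_c^∞(Ω)` in `H¹(Ω)` with respect to the `H¹`-norm. -/
def H10 {d : ℕ} (Ω : Set (EuclideanSpace ℝ (Fin d))) : Set (L2 Ω) :=
  {u | u ∈ H1 Ω ∧ ∀ ε : ℝ, 0 < ε → ∃ w : L2 Ω,
    (∃ φ, IsTestFunction Ω φ ∧ w =ᵐ[volume.restrict Ω] φ) ∧ H1norm (u - w) < ε}

/-- The weak Laplacian `Δu = ∑ᵢ ∂ᵢ∂ᵢ u` of `u ∈ H²(Ω)`. -/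
def weakLaplacian {d : ℕ} {Ω : Set (EuclideanSpace ℝ (Fin d))} (u : L2 Ω) : L2 Ω :=
  ∑ i, weakPartial i (weakPartial i u)

/-! ### The auxiliary PDE -/

/-- `ã(w,v) = ∫_Ω α ∇w·∇v + σ w v`. -/
def pdeForm {d : ℕ} {Ω : Set (EuclideanSpace ℝ (Fin d))}
    (α σ : EuclideanSpace ℝ (Fin d) → ℝ) (w v : L2 Ω) : ℝ :=
  ∫ x in Ω, (α x * ∑ i, weakPartial i w x * weakPartial i v x + σ x * w x * v x)

/-- `ℓ̃(v) = ∫_Ω f v`. -/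
def pdeLoad {d : ℕ} {Ω : Set (EuclideanSpace ℝ (Fin d))} (f v : L2 Ω) : ℝ :=
  ∫ x in Ω, f x * v x

/-! ### The data term -/

/-- The data sets `Bᵢ ⊆ Ω` and their convex extensions `Kᵢ ⊇ Bᵢ`, whose closures cover `Ω`.
(Bounded convex sets with nonempty interior have Lipschitz boundary automatically.) -/
structure DataSets {d : ℕ} (Ω : Set (EuclideanSpace ℝ (Fin d))) (m : ℕ) where
  B : Fin m → Set (EuclideanSpace ℝ (Fin d))
  K : Fin m → Set (EuclideanSpace ℝ (Fin d))
  isOpen_B : ∀ i, IsOpen (B i)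
  nonempty_B : ∀ i, (B i).Nonempty
  B_subset : ∀ i, B i ⊆ Ω
  convex_K : ∀ i, Convex ℝ (K i)
  bounded_K : ∀ i, Bornology.IsBounded (K i)
  B_subset_K : ∀ i, B i ⊆ K i
  cover : Ω ⊆ ⋃ i, closure (K i)

namespace DataSets

variable {d m : ℕ} {Ω : Set (EuclideanSpace ℝ (Fin d))} (D : DataSets Ω m)

/-- The maximal overlap `M = max_{x ∈ Ω} #{i | x ∈ Kᵢ}`. -/
def overlap : ℕ := ⨆ x : Ω, {i | (x : EuclideanSpace ℝ (Fin d)) ∈ D.K i}.ncard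

/-- The maximal diameter `R = maxᵢ diam Kᵢ`. -/
def radius : ℝ := ⨆ i, Metric.diam (D.K i)

/-- The mismatch constant `η`: `1` if `Bᵢ = Kᵢ` for all `i`, and `3 maxᵢ |Kᵢ|/|Bᵢ|` otherwise. -/
def mismatch : ℝ :=
  open Classical in
  if ∀ i, D.B i = D.K i then 1 else 3 * ⨆ i, volume.real (D.K i) / volume.real (D.B i)

theorem volume_B_ne_top (i : Fin m) : volume (D.B i) ≠ ⊤ :=
  ((D.bounded_K i).subset (D.B_subset_K i)).measure_lt_top.ne

theorem restrict_B (i : Fin m) :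
    (volume.restrict Ω).restrict (D.B i) = volume.restrict (D.B i) :=
  Measure.restrict_restrict_of_subset (D.B_subset i)

theorem restrict_apply_B_ne_top (i : Fin m) : (volume.restrict Ω) (D.B i) ≠ ⊤ :=
  ((Measure.restrict_apply_le Ω (D.B i)).trans_lt (D.volume_B_ne_top i).lt_top).ne

theorem average_eq_inner (i : Fin m) (v : L2 Ω) :
    ⨍ x in D.B i, v x = (volume.real (D.B i))⁻¹ *
      inner ℝ (indicatorConstLp 2 (D.isOpen_B i).measurableSet
        (D.restrict_apply_B_ne_top i) (1 : ℝ)) v := by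
  rw [L2.inner_indicatorConstLp_one, D.restrict_B, setAverage_eq, smul_eq_mul]

/-- The average `v ↦ ⨍_{Bᵢ} v` as a continuous linear functional on `L²(Ω)`. -/
def averageCLM (i : Fin m) : L2 Ω →L[ℝ] ℝ where
  toFun v := ⨍ x in D.B i, v x
  map_add' v w := by simp only [D.average_eq_inner, inner_add_right, mul_add]
  map_smul' c v := by
    simp only [D.average_eq_inner, inner_smul_right, smul_eq_mul, RingHom.id_apply]; ring
  cont := by simp only [D.average_eq_inner]; fun_prop

/-- The inexact data term `b̃(u,·) : v ↦ ∑ᵢ bᵢ |Bᵢ| ⨍_{Bᵢ} v` with data `b₁, …, bₘ`. -/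
def dataFunctional (β : Fin m → ℝ) : L2 Ω →L[ℝ] ℝ :=
  ∑ i, (β i * volume.real (D.B i)) • D.averageCLM i

/-- The bilinear form `b(w,v) = ∑ᵢ |Bᵢ| ⨍_{Bᵢ} w ⨍_{Bᵢ} v`, as the functional `b(w,·)`. -/
def dataForm (w : L2 Ω) : L2 Ω →L[ℝ] ℝ :=
  ∑ i, (volume.real (D.B i) * ⨍ x in D.B i, w x) • D.averageCLM i

theorem dataFunctional_apply (β : Fin m → ℝ) (v : L2 Ω) :
    D.dataFunctional β v = ∑ i, β i * volume.real (D.B i) * ⨍ x in D.B i, v x := by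
  simp [dataFunctional, averageCLM]

theorem dataForm_apply (w v : L2 Ω) :
    D.dataForm w v =
      ∑ i, volume.real (D.B i) * (⨍ x in D.B i, w x) * ⨍ x in D.B i, v x := by
  simp [dataForm, averageCLM]

/-- `ũ` solves the PDE-regularized learning problem
`ũ ∈ V`, `ã(ũ,v) + δ⁻¹ b(ũ,v) = ℓ̃(v) + δ⁻¹ b̃(u,v)` for all `v ∈ V`. -/
def IsRegularizedSolution (V : Submodule ℝ (L2 Ω))
    (α σ : EuclideanSpace ℝ (Fin d) → ℝ) (f : L2 Ω) (δ : ℝ) (β : Fin m → ℝ)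
    (uReg : L2 Ω) : Prop :=
  uReg ∈ V ∧ ∀ v ∈ V,
    pdeForm α σ uReg v + δ⁻¹ * D.dataForm uReg v = pdeLoad f v + δ⁻¹ * D.dataFunctional β v

end DataSets

end

/-!
The error `e = ũ - u` lies in `V ⊆ H¹₀(Ω)`. Testing its equation with `e` itself and integrating by
parts in `∫ ∇u · ∇e` (`sum_inner_weakPartial_eq_neg_inner_weakLaplacian`) gives
`‖∇e‖² + δ⁻¹ b(e, e) ≤ (‖Δu‖ + δ⁻¹ ‖b̃ - b(u, ·)‖) ‖e‖`. So everything follows from the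
Poincaré-type inequality `‖e‖² ≤ η (R² M / π² ‖∇e‖² + b(e, e))` on `H¹₀(Ω)`
(`DataSets.norm_sq_le`). By density it suffices to prove it for test functions; summing over the
sets `Kᵢ`, it reduces to the Payne–Weinberger inequality `payne_weinberger` on each `Kᵢ`, where
replacing the average over `Kᵢ` by the average over `Bᵢ` costs the factor `η`.

The Payne–Weinberger inequality is proved by localization. If it fails for a function `u` of mean
zero, then `∫ h < 0` for some `h = c ‖∇u‖² - u² + ε` with `c = (diam K / π)²` and `ε > 0`. Cutting
`K` by hyperplanes that leave `u` with mean zero on both halves, and keeping a half with `∫ h < 0`,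
one reaches convex bodies arbitrarily close to a line (`IsNeedleCandidate.exists_near_line`): the
cuts run through all rational points in all coordinate planes, hence the intersection of the bodies
has no triangle in it. Close to a line `u` is nearly a function of one linear coordinate, and for
such functions the inequality (`variance_comp_inner_le`) is the one-dimensional one with weight
`p(t)`, the volume of the slice at `t`.

By the Prékopa–Leindler inequality (`lintegral_prekopa_leindler`) `p` is log-concave. For a
log-concave weight, with `Φ` the primitive of the centred function times `p`, the one-dimensional
inequality is dual to the Dirichlet inequality `∫ Φ² / p ≤ (L / π)² ∫ (Φ')² / p` on an interval of
length `L` (`dirichlet_inequality`). The latter follows from Picone's identity with the comparison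
function `√p sin(π (x - α) / L)`; the weight `p` need not be differentiable, so the identity is
applied to difference quotients (`integral_sq_mul_le_integral_sq_increment`), for which midpoint
log-concavity is all that is needed.
-/

/-! ### The Prékopa–Leindler inequality -/

open scoped ENNReal Pointwise in
/-- The Brunn–Minkowski inequality on the line. -/
theorem Real.volume_add_le_of_add_mem {A B C : Set ℝ} (hA : MeasurableSet A) (hB : MeasurableSet B)
    (hAn : A.Nonempty) (hBn : B.Nonempty) (h : ∀ a ∈ A, ∀ b ∈ B, a + b ∈ C) :
    volume A + volume B ≤ volume C := by
  have key : ∀ K ⊆ A, IsCompact K → K.Nonempty → ∀ L ⊆ B, IsCompact L → L.Nonempty →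
      volume K + volume L ≤ volume C := by
    intro K hKA hK hKn L hLB hL hLn
    -- The translates of `K` by `min L` and of `L` by `max K` meet in one point only.
    obtain ⟨k, hk, hkmax⟩ := hK.exists_isGreatest hKn
    obtain ⟨l, hl, hlmin⟩ := hL.exists_isLeast hLn
    have hdisj : AEDisjoint volume ((fun x => x + l) '' K) ((fun x => k + x) '' L) := by
      refine measure_mono_null (t := {k + l}) ?_ (measure_singleton _)
      rintro _ ⟨⟨x, hx, rfl⟩, ⟨y, hy, hxy⟩⟩
      have h1 := hkmax hx
      have h2 := hlmin hy
      simp only at hxy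
      simp only [Set.mem_singleton_iff]
      linarith
    have hunion := measure_union₀ (μ := volume) (s := (fun x => x + l) '' K)
      (hL.image (by fun_prop : Continuous fun x => k + x)).measurableSet.nullMeasurableSet hdisj
    have e1 : volume ((fun x => x + l) '' K) = volume K := by
      simp [Set.image_add_right]
    have e2 : volume ((fun x => k + x) '' L) = volume L := by
      simp [Set.image_add_left]
    rw [← e1, ← e2, ← hunion]
    refine measure_mono (Set.union_subset ?_ ?_)
    · rintro _ ⟨x, hx, rfl⟩
      exact h _ (hKA hx) _ (hLB hl)
    · rintro _ ⟨x, hx, rfl⟩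
      exact h _ (hKA hk) _ (hLB hx)
  have key2 : ∀ K ⊆ A, IsCompact K → ∀ L ⊆ B, IsCompact L → volume K + volume L ≤ volume C := by
    intro K hKA hK L hLB hL
    obtain ⟨a, ha⟩ := hAn
    obtain ⟨b, hb⟩ := hBn
    calc volume K + volume L ≤ volume (insert a K) + volume (insert b L) :=
          add_le_add (measure_mono (Set.subset_insert _ _)) (measure_mono (Set.subset_insert _ _))
      _ ≤ volume C := key _ (Set.insert_subset ha hKA) (hK.insert a) (Set.insert_nonempty _ _)
          _ (Set.insert_subset hb hLB) (hL.insert b) (Set.insert_nonempty _ _)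
  rw [hA.measure_eq_iSup_isCompact, hB.measure_eq_iSup_isCompact]
  simp only [iSup_and']
  exact ENNReal.biSup_add_biSup_le' ⟨∅, by simp⟩ ⟨∅, by simp⟩
    fun K hK L hL => key2 K hK.1 hK.2 L hL.1 hL.2

open scoped ENNReal in
theorem ENNReal.geom_mean_le_arith_mean2_weighted {a b : ℝ} (ha : 0 < a) (hb : 0 < b)
    (hab : a + b = 1) (x y : ℝ≥0∞) :
    x ^ a * y ^ b ≤ ENNReal.ofReal a * x + ENNReal.ofReal b * y := by
  rcases eq_or_ne x ⊤ with rfl | hx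
  · simp [ENNReal.mul_top, ha]
  rcases eq_or_ne y ⊤ with rfl | hy
  · simp [ENNReal.mul_top, hb]
  lift x to NNReal using hx
  lift y to NNReal using hy
  have := NNReal.geom_mean_le_arith_mean2_weighted ⟨a, ha.le⟩ ⟨b, hb.le⟩ x y
    (NNReal.eq hab)
  rw [← ENNReal.coe_rpow_of_nonneg _ ha.le, ← ENNReal.coe_rpow_of_nonneg _ hb.le,
    ENNReal.ofReal_eq_coe_nnreal ha.le, ENNReal.ofReal_eq_coe_nnreal hb.le]
  exact_mod_cast this

open scoped ENNReal in
theorem MeasureTheory.lintegral_eq_lintegral_meas_ofReal_lt {α : Type*} [MeasurableSpace α]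
    (μ : Measure α) {f : α → ℝ≥0∞} (hf : Measurable f) (hft : ∀ x, f x ≠ ⊤) :
    ∫⁻ x, f x ∂μ = ∫⁻ t in Set.Ioi (0 : ℝ), μ {x | ENNReal.ofReal t < f x} := by
  have := lintegral_eq_lintegral_meas_lt μ (f := fun x => (f x).toReal)
    (Filter.Eventually.of_forall fun x => ENNReal.toReal_nonneg) hf.ennreal_toReal.aemeasurable
  simp only [ENNReal.ofReal_toReal (hft _)] at this
  rw [this]
  refine setLIntegral_congr_fun measurableSet_Ioi fun t ht => ?_
  simp only [ENNReal.ofReal_lt_iff_lt_toReal (le_of_lt ht) (hft _)]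

open scoped ENNReal Pointwise in
/-- The Prékopa–Leindler inequality on the line, for functions with supremum `1`, where it has an
arithmetic mean on the left: compare superlevel sets by Brunn–Minkowski. -/
theorem lintegral_prekopa_leindler_normalized {a b : ℝ} (ha : 0 < a) (hb : 0 < b)
    (hab : a + b = 1) {f g h : ℝ → ℝ≥0∞} (hf : Measurable f) (hg : Measurable g)
    (hh : Measurable h) (hf1 : ⨆ x, f x = 1) (hg1 : ⨆ x, g x = 1)
    (H : ∀ x y, f x ^ a * g y ^ b ≤ h (a * x + b * y)) :
    ENNReal.ofReal a * (∫⁻ x, f x) + ENNReal.ofReal b * (∫⁻ x, g x) ≤ ∫⁻ x, h x := by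
  have hfle : ∀ x, f x ≤ 1 := fun x => hf1 ▸ le_iSup f x
  have hgle : ∀ x, g x ≤ 1 := fun x => hg1 ▸ le_iSup g x
  calc ENNReal.ofReal a * (∫⁻ x, f x) + ENNReal.ofReal b * (∫⁻ x, g x)
      = ∫⁻ t in Set.Ioi (0 : ℝ), (ENNReal.ofReal a * volume {x | ENNReal.ofReal t < f x}
          + ENNReal.ofReal b * volume {x | ENNReal.ofReal t < g x}) := by
        have mono : ∀ k : ℝ → ℝ≥0∞,
            Antitone fun t : ℝ => volume {x | ENNReal.ofReal t < k x} := fun k s t hst =>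
          measure_mono fun x (hx : _ < _) => lt_of_le_of_lt (ENNReal.ofReal_le_ofReal hst) hx
        rw [lintegral_add_left ((mono f).measurable.const_mul _),
          lintegral_const_mul _ (mono f).measurable, lintegral_const_mul _ (mono g).measurable,
          ← lintegral_eq_lintegral_meas_ofReal_lt _ hf
            fun x => ne_top_of_le_ne_top ENNReal.one_ne_top (hfle x),
          ← lintegral_eq_lintegral_meas_ofReal_lt _ hg
            fun x => ne_top_of_le_ne_top ENNReal.one_ne_top (hgle x)]
    _ ≤ ∫⁻ t in Set.Ioi (0 : ℝ), volume {x | ENNReal.ofReal t < min (h x) 1} := by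
        refine setLIntegral_mono' measurableSet_Ioi fun t (ht : 0 < t) => ?_
        rcases le_or_gt 1 t with ht1 | ht1
        · have ht1' : 1 ≤ ENNReal.ofReal t := by simpa using ht1
          have e1 : {x | ENNReal.ofReal t < f x} = ∅ :=
            Set.eq_empty_of_forall_notMem fun x hx => absurd hx ((hfle x).trans ht1').not_gt
          have e2 : {x | ENNReal.ofReal t < g x} = ∅ :=
            Set.eq_empty_of_forall_notMem fun x hx => absurd hx ((hgle x).trans ht1').not_gt
          simp [e1, e2]
        have ht1' : ENNReal.ofReal t < 1 := by simpa using ht1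
        obtain ⟨x₀, hx₀⟩ := lt_iSup_iff.1 (hf1.symm ▸ ht1')
        obtain ⟨y₀, hy₀⟩ := lt_iSup_iff.1 (hg1.symm ▸ ht1')
        have scale : ∀ {c : ℝ}, 0 < c → ∀ S : Set ℝ,
            ENNReal.ofReal c * volume S = volume (c • S) := fun {c} hc S => by
          simp [Measure.addHaar_smul, abs_of_pos hc]
        rw [scale ha, scale hb]
        refine Real.volume_add_le_of_add_mem
          ((measurableSet_lt measurable_const hf).const_smul₀ a)
          ((measurableSet_lt measurable_const hg).const_smul₀ b)
          (Set.Nonempty.smul_set ⟨x₀, hx₀⟩) (Set.Nonempty.smul_set ⟨y₀, hy₀⟩) ?_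
        rintro _ ⟨x, hx, rfl⟩ _ ⟨y, hy, rfl⟩
        refine lt_min (lt_of_lt_of_le ?_ (H x y)) ht1'
        have ht0 : ENNReal.ofReal t ≠ 0 := by simpa using ht
        calc ENNReal.ofReal t = ENNReal.ofReal t ^ a * ENNReal.ofReal t ^ b := by
              rw [← ENNReal.rpow_add _ _ ht0 ENNReal.ofReal_ne_top, hab, ENNReal.rpow_one]
          _ < f x ^ a * g y ^ b := ENNReal.mul_lt_mul (ENNReal.rpow_lt_rpow hx ha)
              (ENNReal.rpow_lt_rpow hy hb)
    _ = ∫⁻ x, min (h x) 1 := by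
        rw [lintegral_eq_lintegral_meas_ofReal_lt _ (hh.min measurable_const)
          fun x => ne_top_of_le_ne_top ENNReal.one_ne_top (min_le_right _ _)]
    _ ≤ ∫⁻ x, h x := lintegral_mono fun x => min_le_left _ _

open scoped ENNReal in
/-- The Prékopa–Leindler inequality on the line, for bounded functions, by scaling their suprema
to `1`. -/
theorem lintegral_prekopa_leindler_of_iSup_ne_top {a b : ℝ} (ha : 0 < a) (hb : 0 < b)
    (hab : a + b = 1) {f g h : ℝ → ℝ≥0∞} (hf : Measurable f) (hg : Measurable g)
    (hh : Measurable h) (hft : ⨆ x, f x ≠ ⊤) (hgt : ⨆ x, g x ≠ ⊤)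
    (H : ∀ x y, f x ^ a * g y ^ b ≤ h (a * x + b * y)) :
    (∫⁻ x, f x) ^ a * (∫⁻ x, g x) ^ b ≤ ∫⁻ x, h x := by
  set A := ⨆ x, f x with hA
  set B := ⨆ x, g x with hB
  rcases eq_or_ne A 0 with hA0 | hA0
  · have : ∀ x, f x = 0 := by simpa [hA] using hA0
    simp [this, ENNReal.zero_rpow_of_pos ha]
  rcases eq_or_ne B 0 with hB0 | hB0
  · have : ∀ x, g x = 0 := by simpa [hB] using hB0
    simp [this, ENNReal.zero_rpow_of_pos hb]
  have hC : ∀ x y : ℝ≥0∞, (A⁻¹ * x) ^ a * (B⁻¹ * y) ^ b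
      = (A⁻¹ ^ a * B⁻¹ ^ b) * (x ^ a * y ^ b) := fun x y => by
    rw [ENNReal.mul_rpow_of_nonneg _ _ ha.le, ENNReal.mul_rpow_of_nonneg _ _ hb.le]; ring
  have hC0 : A⁻¹ ^ a * B⁻¹ ^ b ≠ 0 := mul_ne_zero
    (by simp [ENNReal.rpow_eq_zero_iff, ha, hft, ha.not_gt])
    (by simp [ENNReal.rpow_eq_zero_iff, hb, hgt, hb.not_gt])
  have hCt : A⁻¹ ^ a * B⁻¹ ^ b ≠ ⊤ := ENNReal.mul_ne_top
    (ENNReal.rpow_ne_top_of_nonneg ha.le (by simpa using hA0))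
    (ENNReal.rpow_ne_top_of_nonneg hb.le (by simpa using hB0))
  have := lintegral_prekopa_leindler_normalized ha hb hab (f := fun x => A⁻¹ * f x)
    (g := fun x => B⁻¹ * g x) (h := fun x => (A⁻¹ ^ a * B⁻¹ ^ b) * h x)
    (hf.const_mul _) (hg.const_mul _) (hh.const_mul _)
    (by rw [← ENNReal.mul_iSup, ← hA, ENNReal.inv_mul_cancel hA0 hft])
    (by rw [← ENNReal.mul_iSup, ← hB, ENNReal.inv_mul_cancel hB0 hgt])
    (fun x y => by rw [hC]; gcongr; exact H x y)
  have h2 := (ENNReal.geom_mean_le_arith_mean2_weighted ha hb hab _ _).trans this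
  rw [lintegral_const_mul _ hf, lintegral_const_mul _ hg, lintegral_const_mul _ hh, hC] at h2
  exact (ENNReal.mul_le_mul_iff_right hC0 hCt).1 h2

open scoped ENNReal in
/-- The Prékopa–Leindler inequality on the line, by truncation to bounded functions. -/
theorem lintegral_prekopa_leindler_real {a b : ℝ} (ha : 0 < a) (hb : 0 < b)
    (hab : a + b = 1) {f g h : ℝ → ℝ≥0∞} (hf : Measurable f) (hg : Measurable g)
    (hh : Measurable h) (H : ∀ x y, f x ^ a * g y ^ b ≤ h (a * x + b * y)) :
    (∫⁻ x, f x) ^ a * (∫⁻ x, g x) ^ b ≤ ∫⁻ x, h x := by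
  rcases eq_or_ne (∫⁻ x, f x) 0 with hf0 | hf0
  · simp [hf0, ENNReal.zero_rpow_of_pos ha]
  rcases eq_or_ne (∫⁻ x, g x) 0 with hg0 | hg0
  · simp [hg0, ENNReal.zero_rpow_of_pos hb]
  have lim : ∀ k : ℝ → ℝ≥0∞, Measurable k → Filter.Tendsto
      (fun n : ℕ => ∫⁻ x, min (k x) n) Filter.atTop (nhds (∫⁻ x, k x)) := fun k hk => by
    refine lintegral_tendsto_of_tendsto_of_monotone
      (fun n => (hk.min measurable_const).aemeasurable)
      (Filter.Eventually.of_forall fun x m n hmn => min_le_min_left _ (by exact_mod_cast hmn))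
      (Filter.Eventually.of_forall fun x => ?_)
    simpa using (tendsto_const_nhds (x := k x)).min ENNReal.tendsto_nat_nhds_top
  have hbd : ∀ (k : ℝ → ℝ≥0∞) (n : ℕ), ⨆ x, min (k x) n ≠ ⊤ := fun k n =>
    ne_top_of_le_ne_top (ENNReal.natCast_ne_top n) (iSup_le fun x => min_le_right _ _)
  refine le_of_tendsto (ENNReal.Tendsto.mul
    ((ENNReal.continuous_rpow_const (y := a)).continuousAt.tendsto.comp (lim f hf)) (Or.inl ?_)
    ((ENNReal.continuous_rpow_const (y := b)).continuousAt.tendsto.comp (lim g hg)) (Or.inl ?_))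
    (Filter.Eventually.of_forall fun n => ?_)
  · simp [ENNReal.rpow_eq_zero_iff, hf0, ha.not_gt]
  · simp [ENNReal.rpow_eq_zero_iff, hg0, hb.not_gt]
  · refine lintegral_prekopa_leindler_of_iSup_ne_top ha hb hab (hf.min measurable_const)
      (hg.min measurable_const) hh (hbd f n) (hbd g n) fun x y => le_trans ?_ (H x y)
    gcongr <;> exact min_le_left _ _

open scoped ENNReal in
/-- The Prékopa–Leindler inequality, by induction on the dimension. -/
theorem lintegral_prekopa_leindler {n : ℕ} {a b : ℝ} (ha : 0 < a) (hb : 0 < b)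
    (hab : a + b = 1) {f g h : (Fin n → ℝ) → ℝ≥0∞} (hf : Measurable f) (hg : Measurable g)
    (hh : Measurable h) (H : ∀ x y, f x ^ a * g y ^ b ≤ h (a • x + b • y)) :
    (∫⁻ x, f x) ^ a * (∫⁻ x, g x) ^ b ≤ ∫⁻ x, h x := by
  induction n with
  | zero =>
    simp only [lintegral_unique, Measure.volume_pi_eq_dirac default, measure_univ, mul_one]
    exact (H _ _).trans_eq (congrArg h (Subsingleton.elim _ _))
  | succ n ih =>
    have fub : ∀ k : (Fin (n + 1) → ℝ) → ℝ≥0∞, Measurable k →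
        Measurable (fun p : ℝ × (Fin n → ℝ) => k (Fin.cons p.1 p.2)) ∧
        ∫⁻ x, k x = ∫⁻ t : ℝ, ∫⁻ y : Fin n → ℝ, k (Fin.cons t y) := fun k hk => by
      have e := (volume_preserving_piFinSuccAbove (fun _ : Fin (n + 1) => ℝ) 0).symm
      have hm : Measurable (fun p : ℝ × (Fin n → ℝ) => k (Fin.cons p.1 p.2)) := by
        simpa [Function.comp_def, MeasurableEquiv.piFinSuccAbove, Fin.insertNthEquiv]
          using hk.comp e.measurable
      refine ⟨hm, ?_⟩
      rw [← e.lintegral_comp hk]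
      simp only [MeasurableEquiv.piFinSuccAbove, Fin.insertNthEquiv, MeasurableEquiv.symm_mk,
        MeasurableEquiv.coe_mk, Equiv.symm_symm, Equiv.coe_fn_mk, Fin.insertNth_zero']
      exact lintegral_prod _ hm.aemeasurable
    rw [(fub f hf).2, (fub g hg).2, (fub h hh).2]
    refine lintegral_prekopa_leindler_real ha hb hab (fub f hf).1.lintegral_prod_right'
      (fub g hg).1.lintegral_prod_right' (fub h hh).1.lintegral_prod_right' fun s t => ?_
    refine ih ((fub f hf).1.comp measurable_prodMk_left) ((fub g hg).1.comp measurable_prodMk_left)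
      ((fub h hh).1.comp measurable_prodMk_left) fun x y => ?_
    convert H (Fin.cons s x) (Fin.cons t y) using 2
    ext i
    refine Fin.cases ?_ (fun j => ?_) i <;> simp

/-! ### The Poincaré inequality for log-concave weights on an interval -/

/-- A discrete Picone identity: it bounds the quadratic form of the increments of `F` from below by
a potential term. The two halves of the potential come from the same term by translation. -/
theorem integral_sq_mul_le_integral_sq_increment {r ψ F : ℝ → ℝ} (hr : Continuous r)
    (hψ : Continuous ψ) (hψ0 : ∀ x, 0 < ψ x) (hF : Continuous F) (hFc : HasCompactSupport F)
    (s : ℝ) :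
    ∫ x, F x ^ 2 * (r x * (r (x + s) + r (x - s)) - r x ^ 2 * ((ψ (x + s) + ψ (x - s)) / ψ x)) ≤
      ∫ x, (F (x + s) - F x) ^ 2 * (r x * r (x + s)) := by
  have hψne : ∀ x, ψ x ≠ 0 := fun x => (hψ0 x).ne'
  have comp : ∀ c : ℝ → ℝ, Continuous c → Integrable fun x => F x ^ 2 * c x := fun c hc =>
    Continuous.integrable_of_hasCompactSupport (by fun_prop)
      (hFc.mono' ((subset_tsupport F).trans' fun x hx hx0 => hx (by simp [hx0])))
  set B : ℝ → ℝ := fun x => F x ^ 2 * (r x * r (x + s) - r x ^ 2 * (ψ (x + s) / ψ x)) with hB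
  set C : ℝ → ℝ := fun x => F x ^ 2 * (r x * r (x - s) - r x ^ 2 * (ψ (x - s) / ψ x)) with hC
  have iB : Integrable B := comp _ (by fun_prop (disch := assumption))
  have iC : Integrable C := comp _ (by fun_prop (disch := assumption))
  have hFs : HasCompactSupport fun x => F (x + s) := hFc.comp_homeomorph (Homeomorph.addRight s)
  calc _ = ∫ x, (B x + C x) := by
        congr 1; ext x; simp only [hB, hC]; field_simp; ring
    _ = ∫ x, (B x + C (x + s)) := by
        rw [integral_add iB iC, integral_add iB (iC.comp_add_right s),
          integral_add_right_eq_self C s]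
    _ ≤ _ := by
        refine integral_mono (iB.add (iC.comp_add_right s)) ?_ fun x => ?_
        · refine Continuous.integrable_of_hasCompactSupport (by fun_prop) ?_
          refine HasCompactSupport.mul_right ?_
          have : HasCompactSupport fun x => F (x + s) - F x := hFs.sub hFc
          exact this.comp_left (g := fun y => y ^ 2) (by simp)
        · simp only [hB, hC, add_sub_cancel_right]
          set k := ψ (x + s) / ψ x with hk
          have hk0 : 0 < k := div_pos (hψ0 _) (hψ0 _)
          have hkinv : ψ x / ψ (x + s) = k⁻¹ := by rw [hk, inv_div]
          rw [hkinv]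
          have h1 : 0 ≤ k⁻¹ * (k * (F x * r x) - F (x + s) * r (x + s)) ^ 2 := by positivity
          have h2 : k⁻¹ * (k * (F x * r x) - F (x + s) * r (x + s)) ^ 2 =
              k * (F x * r x) ^ 2 - 2 * (F x * r x) * (F (x + s) * r (x + s))
                + k⁻¹ * (F (x + s) * r (x + s)) ^ 2 := by
            field_simp; ring
          nlinarith

/-- If `r` is midpoint convex at the points of `[a, b]` and `ψ > 0` satisfies there the difference
equation of a wave of frequency `ν`, then `ν²` is at most the first Dirichlet eigenvalue of the
weight `r²` on `[a, b]`: divide the discrete inequality by `s²` and let `s` tend to zero. -/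
theorem dirichlet_inequality {a b : ℝ} (hab : a ≤ b) {r ψ Φ g : ℝ → ℝ} {ν σ : ℝ}
    (hr : Continuous r) (hr0 : ∀ x, 0 < r x) (hψ : Continuous ψ) (hψ0 : ∀ x, 0 < ψ x)
    (hσ : 0 < σ)
    (hrm : ∀ x ∈ Set.Icc a b, ∀ s, 0 < s → s < σ → 2 * r x ≤ r (x + s) + r (x - s))
    (hψm : ∀ x ∈ Set.Icc a b, ∀ s, 0 < s → s < σ →
      ψ (x + s) + ψ (x - s) = 2 * Real.cos (ν * s) * ψ x)
    (hg : Continuous g) (hΦ : ∀ x, HasDerivAt Φ (g x) x) (ha : Φ a = 0) (hb : Φ b = 0) :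
    ν ^ 2 * ∫ x in a..b, Φ x ^ 2 * r x ^ 2 ≤ ∫ x in a..b, g x ^ 2 * r x ^ 2 := by
  -- `F` is the extension of `Φ` by zero.
  set c : ℝ → ℝ := fun x => max a (min x b) with hc
  have hcmem : ∀ x, c x ∈ Set.Icc a b := fun x =>
    ⟨le_max_left _ _, max_le hab (min_le_right _ _)⟩
  have hcid : ∀ x ∈ Set.Icc a b, c x = x := fun x hx => by simp [hc, hx.1, hx.2]
  have hΦc : Continuous Φ := continuous_iff_continuousAt.2 fun x => (hΦ x).continuousAt
  set F : ℝ → ℝ := fun x => Φ (c x) with hF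
  have hFcont : Continuous F := hΦc.comp (by fun_prop)
  have hFoff : ∀ x, x ∉ Set.Ioo a b → F x = 0 := fun x hx => by
    rcases le_or_gt x a with h | h
    · simp [hF, hc, min_eq_left (h.trans hab), h, ha]
    · have hbx : b ≤ x := not_lt.1 fun h' => hx ⟨h, h'⟩
      simp [hF, hc, hbx, hab, hb]
  have hFcpt : HasCompactSupport F := HasCompactSupport.of_support_subset_isCompact
    (isCompact_Icc (a := a) (b := b)) fun x hx => by
      by_contra h; exact hx (hFoff x fun h' => h (Set.Ioo_subset_Icc_self h'))
  set G : ℝ → ℝ := Set.indicator (Set.Ioo a b) g with hG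
  have hFder : ∀ x, x ≠ a → x ≠ b → HasDerivAt F (G x) x := fun x hxa hxb => by
    by_cases hx : x ∈ Set.Ioo a b
    · rw [hG, Set.indicator_of_mem hx]
      refine (hΦ x).congr_of_eventuallyEq ?_
      filter_upwards [isOpen_Ioo.mem_nhds hx] with y hy
      simp only [hF, hcid y (Set.Ioo_subset_Icc_self hy)]
    · rw [hG, Set.indicator_of_notMem hx]
      refine (hasDerivAt_const x (0 : ℝ)).congr_of_eventuallyEq ?_
      have hx' : x ∈ (Set.Icc a b)ᶜ := fun h =>
        hx ⟨lt_of_le_of_ne h.1 (Ne.symm hxa), lt_of_le_of_ne h.2 hxb⟩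
      filter_upwards [isClosed_Icc.isOpen_compl.mem_nhds hx'] with y hy
      exact hFoff y fun h => hy (Set.Ioo_subset_Icc_self h)
  obtain ⟨A, hA⟩ := (isCompact_Icc (a := a) (b := b)).exists_bound_of_continuousOn hg.continuousOn
  have hFlip : ∀ x y, |F x - F y| ≤ A * |x - y| := fun x y => by
    have h1 := (convex_Icc a b).norm_image_sub_le_of_norm_hasDerivWithin_le
      (fun z hz => (hΦ z).hasDerivWithinAt) hA (hcmem y) (hcmem x)
    have h2 : |c x - c y| ≤ |x - y| := by
      simp only [hc]
      exact (abs_max_sub_max_le_max _ _ _ _).trans (by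
        simp only [sub_self, abs_zero]
        exact max_le (abs_nonneg _) ((abs_min_sub_min_le_max _ _ _ _).trans (by simp)))
    have hA0 : 0 ≤ A := (norm_nonneg _).trans (hA a ⟨le_rfl, hab⟩)
    exact h1.trans (mul_le_mul_of_nonneg_left h2 hA0)
  obtain ⟨R, hR⟩ := (isCompact_Icc (a := a - 1) (b := b + 1)).exists_bound_of_continuousOn
    hr.continuousOn
  have hIF : ∫ x, F x ^ 2 * r x ^ 2 = ∫ x in a..b, Φ x ^ 2 * r x ^ 2 := by
    rw [intervalIntegral.integral_of_le hab, ← setIntegral_eq_integral_of_forall_compl_eq_zero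
      (s := Set.Ioc a b)]
    · exact setIntegral_congr_fun measurableSet_Ioc fun x hx => by
        simp only [hF, hcid x (Set.Ioc_subset_Icc_self hx)]
    · intro x hx
      simp [hFoff x fun h => hx (Set.Ioo_subset_Ioc_self h)]
  have hIG : ∫ x, G x ^ 2 * r x ^ 2 = ∫ x in a..b, g x ^ 2 * r x ^ 2 := by
    rw [intervalIntegral.integral_of_le hab, integral_Ioc_eq_integral_Ioo,
      ← setIntegral_eq_integral_of_forall_compl_eq_zero (s := Set.Ioo a b)]
    · exact setIntegral_congr_fun measurableSet_Ioo fun x hx => by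
        simp only [hG, Set.indicator_of_mem hx]
    · intro x hx
      simp [hG, hx]
  rw [← hIF, ← hIG]
  have hlimR : Filter.Tendsto
      (fun s => ∫ x, ((F (x + s) - F x) / s) ^ 2 * (r x * r (x + s))) (nhdsWithin 0 (Set.Ioi 0))
      (nhds (∫ x, G x ^ 2 * r x ^ 2)) := by
    refine tendsto_integral_filter_of_dominated_convergence
      (Set.indicator (Set.Icc (a - 1) (b + 1)) fun _ => A ^ 2 * (R * R)) ?_ ?_ ?_ ?_
    · refine Filter.Eventually.of_forall fun s => Continuous.aestronglyMeasurable ?_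
      simp only [div_eq_mul_inv]
      fun_prop
    · have h1 : Set.Ioo (0 : ℝ) 1 ∈ nhdsWithin (0 : ℝ) (Set.Ioi 0) := Ioo_mem_nhdsGT one_pos
      filter_upwards [h1] with s hs
      refine Filter.Eventually.of_forall fun x => ?_
      by_cases hz : x ∉ Set.Ioo a b ∧ x + s ∉ Set.Ioo a b
      · rw [hFoff _ hz.1, hFoff _ hz.2]
        simp only [sub_self, zero_div, ne_eq, OfNat.ofNat_ne_zero, not_false_eq_true, zero_pow,
          zero_mul, norm_zero]
        exact Set.indicator_nonneg (fun _ _ => mul_nonneg (sq_nonneg _) (mul_self_nonneg _)) _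
      · have hx : x ∈ Set.Icc (a - 1) (b + 1) ∧ x + s ∈ Set.Icc (a - 1) (b + 1) := by
          rw [not_and_or, not_not, not_not] at hz
          simp only [Set.mem_Icc]
          rcases hz with hz | hz <;> refine ⟨⟨?_, ?_⟩, ⟨?_, ?_⟩⟩ <;>
            linarith [hz.1, hz.2, hs.1, hs.2]
        rw [Set.indicator_of_mem hx.1, norm_mul, norm_pow, norm_div, norm_mul]
        have h2 : ‖F (x + s) - F x‖ / ‖s‖ ≤ A := by
          rw [div_le_iff₀ (by simpa using hs.1.ne')]
          simpa using hFlip (x + s) x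
        have h3 := hR _ hx.1
        have h4 := hR _ hx.2
        have hR0 : 0 ≤ R := (norm_nonneg _).trans h3
        gcongr
    · exact (integrable_indicator_iff measurableSet_Icc).2
        (continuousOn_const.integrableOn_compact isCompact_Icc)
    · have hae : ∀ᵐ x : ℝ, x ≠ a ∧ x ≠ b :=
        (Measure.ae_ne volume a).and (Measure.ae_ne volume b)
      filter_upwards [hae] with x hx
      have h1 := ((hFder x hx.1 hx.2).tendsto_slope_zero_right)
      have h2 : Filter.Tendsto (fun s => r (x + s)) (nhdsWithin 0 (Set.Ioi 0)) (nhds (r x)) := by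
        have : ContinuousAt (fun s => r (x + s)) 0 := by fun_prop
        simpa using this.tendsto.mono_left nhdsWithin_le_nhds
      have h3 := (h1.pow 2).mul (h2.const_mul (r x))
      rw [← pow_two] at h3
      refine h3.congr fun s => ?_
      simp only [smul_eq_mul, div_eq_inv_mul]
  have hlimL : Filter.Tendsto (fun s : ℝ => (2 * (Real.sin (ν / 2 * s) / s)) ^ 2 *
      ∫ x, F x ^ 2 * r x ^ 2) (nhdsWithin 0 (Set.Ioi 0))
      (nhds (ν ^ 2 * ∫ x, F x ^ 2 * r x ^ 2)) := by
    have h1 : HasDerivAt (fun s => Real.sin (ν / 2 * s)) (ν / 2) 0 := by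
      simpa using ((hasDerivAt_id (0 : ℝ)).const_mul (ν / 2)).sin
    have h2 := ((h1.tendsto_slope_zero_right.const_mul 2).pow 2).mul_const
      (∫ x, F x ^ 2 * r x ^ 2)
    rw [mul_div_cancel₀ _ (two_ne_zero)] at h2
    refine h2.congr fun s => ?_
    simp [div_eq_inv_mul]
  refine le_of_tendsto_of_tendsto hlimL hlimR ?_
  have h1 : Set.Ioo (0 : ℝ) σ ∈ nhdsWithin (0 : ℝ) (Set.Ioi 0) := Ioo_mem_nhdsGT hσ
  filter_upwards [h1] with s hs
  have key := integral_sq_mul_le_integral_sq_increment hr hψ hψ0 hFcont hFcpt s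
  have hlow : (2 * Real.sin (ν / 2 * s)) ^ 2 * ∫ x, F x ^ 2 * r x ^ 2 ≤
      ∫ x, F x ^ 2 *
        (r x * (r (x + s) + r (x - s)) - r x ^ 2 * ((ψ (x + s) + ψ (x - s)) / ψ x)) := by
    rw [← integral_const_mul]
    have comp : ∀ k : ℝ → ℝ, Continuous k → Integrable fun x => F x ^ 2 * k x := fun k hk =>
      Continuous.integrable_of_hasCompactSupport (by fun_prop)
        (hFcpt.mono' ((subset_tsupport F).trans' fun x hx hx0 => hx (by simp [hx0])))
    have hψne : ∀ x, ψ x ≠ 0 := fun x => (hψ0 x).ne'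
    refine integral_mono ((comp _ (by fun_prop)).const_mul _)
      (comp _ (by fun_prop (disch := assumption))) fun x => ?_
    by_cases hx : x ∈ Set.Ioo a b
    · have hx' := Set.Ioo_subset_Icc_self hx
      simp only
      rw [hψm x hx' s hs.1 hs.2, mul_div_cancel_right₀ _ (hψne x)]
      have e : (2 * Real.sin (ν / 2 * s)) ^ 2 = 2 - 2 * Real.cos (ν * s) := by
        have : ν * s = 2 * (ν / 2 * s) := by ring
        rw [this, Real.cos_two_mul, mul_pow, Real.sin_sq]; ring
      rw [e]
      have h2 := mul_le_mul_of_nonneg_left (hrm x hx' s hs.1 hs.2) (hr0 x).le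
      have h3 := mul_le_mul_of_nonneg_left h2 (sq_nonneg (F x))
      nlinarith
    · simp [hFoff x hx]
  have hs2 : 0 < (s ^ 2)⁻¹ := by have := hs.1; positivity
  have h5 := mul_le_mul_of_nonneg_left (hlow.trans key) hs2.le
  rw [← integral_const_mul (s ^ 2)⁻¹ (fun x => (F (x + s) - F x) ^ 2 * (r x * r (x + s)))] at h5
  convert h5 using 1
  · field_simp
  · congr 1; ext x; field_simp

theorem two_mul_inv_sqrt_le {x y z : ℝ} (hx : 0 < x) (hy : 0 < y) (hz : 0 < z)
    (h : y * z ≤ x ^ 2) : 2 * (√x)⁻¹ ≤ (√y)⁻¹ + (√z)⁻¹ := by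
  have hx' := Real.sqrt_pos.2 hx
  have hy' := Real.sqrt_pos.2 hy
  have hz' := Real.sqrt_pos.2 hz
  have h1 : √y * √z ≤ √x ^ 2 := by
    rw [← Real.sqrt_mul hy.le, Real.sq_sqrt hx.le]
    exact (Real.sqrt_le_sqrt h).trans_eq (Real.sqrt_sq hx.le)
  have h2 : √y * √z * (2 * (√x)⁻¹) ^ 2 ≤ 4 := by
    rw [mul_pow, inv_pow]
    have : 0 < √x ^ 2 := by positivity
    calc √y * √z * (2 ^ 2 * (√x ^ 2)⁻¹) ≤ √x ^ 2 * (2 ^ 2 * (√x ^ 2)⁻¹) := by gcongr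
      _ = 4 := by field_simp; norm_num
  have h3 : 4 ≤ √y * √z * ((√y)⁻¹ + (√z)⁻¹) ^ 2 := by
    have : √y * √z * ((√y)⁻¹ + (√z)⁻¹) ^ 2 = 4 + (√y - √z) ^ 2 * (√y * √z)⁻¹ := by
      field_simp; ring
    rw [this]
    have : 0 ≤ (√y - √z) ^ 2 * (√y * √z)⁻¹ := by positivity
    linarith
  exact (pow_le_pow_iff_left₀ (by positivity) (by positivity) two_ne_zero).1
    (le_of_mul_le_mul_left (h2.trans h3) (mul_pos hy' hz'))

/-- The variance inequality on a compact subinterval. If `Φ` is the primitive of the centred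
`(f - m) p`, then `∫ (f - m)² p = -∫ f' Φ`, so that the variance is controlled by the Dirichlet
problem for `Φ` with the reciprocal weight `1 / p`. -/
theorem weighted_variance_le_Icc {α β a b : ℝ} (hαa : α < a) (hab : a < b) (hbβ : b < β)
    {p f : ℝ → ℝ} (hp : ContinuousOn p (Set.Ioo α β)) (hp0 : ∀ x ∈ Set.Ioo α β, 0 < p x)
    (hpm : ∀ x s, x - s ∈ Set.Ioo α β → x + s ∈ Set.Ioo α β → p (x + s) * p (x - s) ≤ p x ^ 2)
    (hf : ContDiff ℝ 1 f) :
    (∫ x in a..b, p x) * (∫ x in a..b, f x ^ 2 * p x) - (∫ x in a..b, f x * p x) ^ 2 ≤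
      ((β - α) / Real.pi) ^ 2 * ((∫ x in a..b, p x) * ∫ x in a..b, deriv f x ^ 2 * p x) := by
  have hpi := Real.pi_pos
  set c : ℝ → ℝ := fun x => max ((α + a) / 2) (min x ((b + β) / 2)) with hc
  have hcc : Continuous c := by fun_prop
  have hcmem : ∀ x, c x ∈ Set.Ioo α β := fun x =>
    ⟨lt_max_of_lt_left (by linarith), max_lt (by linarith) (min_lt_of_right_lt (by linarith))⟩
  have hcid : ∀ x, (α + a) / 2 ≤ x → x ≤ (b + β) / 2 → c x = x := fun x h1 h2 => by
    simp [hc, h1, h2]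
  have hcid' : ∀ x ∈ Set.Icc a b, c x = x := fun x hx =>
    hcid x (by linarith [hx.1]) (by linarith [hx.2])
  -- `P` is a positive continuous function on the line that agrees with `p` near `[a, b]`.
  set P : ℝ → ℝ := fun x => p (c x) with hP
  have hPc : Continuous P := hp.comp_continuous hcc hcmem
  have hP0 : ∀ x, 0 < P x := fun x => hp0 _ (hcmem x)
  have hPp : ∀ k : ℝ → ℝ, ∫ x in a..b, k x * p x = ∫ x in a..b, k x * P x := fun k =>
    intervalIntegral.integral_congr fun x hx => by
      rw [Set.uIcc_of_le hab.le] at hx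
      simp only [hP, hcid' x hx]
  have hPp1 : ∫ x in a..b, p x = ∫ x in a..b, P x := by simpa using hPp fun _ => 1
  rw [hPp, hPp, hPp, hPp1]
  have hfc : Continuous f := hf.continuous
  have hf'c : Continuous (deriv f) := hf.continuous_deriv le_rfl
  have I0 : 0 < ∫ x in a..b, P x :=
    intervalIntegral.intervalIntegral_pos_of_pos (hPc.intervalIntegrable _ _) hP0 hab
  set m := (∫ x in a..b, f x * P x) / ∫ x in a..b, P x with hm
  set g : ℝ → ℝ := fun x => (f x - m) * P x with hg
  have hgc : Continuous g := by fun_prop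
  set Φ : ℝ → ℝ := fun x => ∫ t in a..x, g t with hΦ
  have hΦd : ∀ x, HasDerivAt Φ (g x) x := fun x => hgc.integral_hasStrictDerivAt a x |>.hasDerivAt
  have hΦc : Continuous Φ := continuous_iff_continuousAt.2 fun x => (hΦd x).continuousAt
  have hΦa : Φ a = 0 := by simp [hΦ]
  have hint : ∀ k : ℝ → ℝ, Continuous k → IntervalIntegrable k volume a b := fun k hk =>
    hk.intervalIntegrable _ _
  have hΦb : Φ b = 0 := by
    simp only [hΦ, hg, sub_mul]
    rw [intervalIntegral.integral_sub (hint _ (by fun_prop)) (hint _ (by fun_prop)),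
      intervalIntegral.integral_const_mul, hm, div_mul_cancel₀ _ I0.ne', sub_self]
  set r : ℝ → ℝ := fun x => (√(P x))⁻¹ with hr
  have hs0 : ∀ x, √(P x) ≠ 0 := fun x => (Real.sqrt_pos.2 (hP0 x)).ne'
  have hrc : Continuous r := by fun_prop (disch := assumption)
  have hr2 : ∀ x, r x ^ 2 = (P x)⁻¹ := fun x => by
    simp only [hr, inv_pow, Real.sq_sqrt (hP0 x).le]
  set ν := Real.pi / (β - α) with hν
  have hαβ : 0 < β - α := by linarith
  have hν0 : 0 < ν := div_pos hpi hαβ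
  have hdir := dirichlet_inequality hab.le (r := r) (ψ := fun x => Real.sin (ν * (c x - α)))
    (Φ := Φ) (g := g) (ν := ν) (σ := min ((a - α) / 2) ((β - b) / 2)) hrc
    (fun x => inv_pos.2 (Real.sqrt_pos.2 (hP0 x))) (by fun_prop)
    (fun x => Real.sin_pos_of_pos_of_lt_pi (mul_pos hν0 (by linarith [(hcmem x).1])) (by
      rw [hν, div_mul_eq_mul_div, div_lt_iff₀ hαβ]
      exact mul_lt_mul_of_pos_left (by linarith [(hcmem x).2]) hpi))
    (lt_min (by linarith) (by linarith))
    (fun x hx s hs0 hs => by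
      have h1 := lt_min_iff.1 hs
      have e1 : c (x + s) = x + s := hcid _ (by linarith [hx.1]) (by linarith [hx.2])
      have e2 : c (x - s) = x - s := hcid _ (by linarith [hx.1]) (by linarith [hx.2])
      refine two_mul_inv_sqrt_le (hP0 _) (hP0 _) (hP0 _) ?_
      simp only [hP, e1, e2, hcid' x hx]
      exact hpm x s (e2 ▸ hcmem _) (e1 ▸ hcmem _))
    (fun x hx s hs0 hs => by
      have h1 := lt_min_iff.1 hs
      have e1 : c (x + s) = x + s := hcid _ (by linarith [hx.1]) (by linarith [hx.2])
      have e2 : c (x - s) = x - s := hcid _ (by linarith [hx.1]) (by linarith [hx.2])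
      simp only [e1, e2, hcid' x hx]
      have e3 : ν * (x + s - α) = ν * (x - α) + ν * s := by ring
      have e4 : ν * (x - s - α) = ν * (x - α) - ν * s := by ring
      rw [e3, e4, Real.sin_add, Real.sin_sub]; ring)
    hgc hΦd hΦa hΦb
  set V := ∫ x in a..b, (f x - m) ^ 2 * P x with hV
  have hgV : ∫ x in a..b, g x ^ 2 * r x ^ 2 = V :=
    intervalIntegral.integral_congr fun x _ => by
      have := (hP0 x).ne'
      simp only [hg, hr2]; field_simp
  rw [hgV] at hdir
  have hibp : V = -∫ x in a..b, deriv f x * Φ x := by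
    have := intervalIntegral.integral_mul_deriv_eq_deriv_mul (a := a) (b := b)
      (u := fun x => f x - m) (v := Φ) (u' := deriv f) (v' := g)
      (fun x _ => ((hf.differentiable one_ne_zero).differentiableAt.hasDerivAt).sub_const m)
      (fun x _ => hΦd x) (hint _ hf'c) (hint _ hgc)
    rw [hΦa, hΦb] at this
    simp only [mul_zero, sub_self, zero_sub] at this
    rw [← this, hV]
    exact intervalIntegral.integral_congr fun x _ => by simp only [hg]; ring
  have hyoung : 2 * V ≤ (ν ^ 2)⁻¹ * (∫ x in a..b, deriv f x ^ 2 * P x)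
      + ν ^ 2 * ∫ x in a..b, Φ x ^ 2 * r x ^ 2 := by
    rw [hibp, ← intervalIntegral.integral_neg, ← intervalIntegral.integral_const_mul,
      ← intervalIntegral.integral_const_mul, ← intervalIntegral.integral_const_mul,
      ← intervalIntegral.integral_add (hint _ (by fun_prop)) (hint _ (by fun_prop))]
    refine intervalIntegral.integral_mono_on hab.le (hint _ (by fun_prop)) (hint _ (by fun_prop))
      fun x _ => ?_
    rw [hr2]
    have hPx := hP0 x
    have h1 : 0 ≤ (ν ^ 2)⁻¹ * (P x)⁻¹ * (deriv f x * P x + ν ^ 2 * Φ x) ^ 2 := by positivity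
    have h2 : (ν ^ 2)⁻¹ * (P x)⁻¹ * (deriv f x * P x + ν ^ 2 * Φ x) ^ 2 =
        (ν ^ 2)⁻¹ * (deriv f x ^ 2 * P x) + 2 * (deriv f x * Φ x)
          + ν ^ 2 * (Φ x ^ 2 * (P x)⁻¹) := by
      field_simp; ring
    linarith
  have hVle : V ≤ (ν ^ 2)⁻¹ * ∫ x in a..b, deriv f x ^ 2 * P x := by linarith
  have hVexp : (∫ x in a..b, P x) * V =
      (∫ x in a..b, P x) * (∫ x in a..b, f x ^ 2 * P x) - (∫ x in a..b, f x * P x) ^ 2 := by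
    have h1 : V = (∫ x in a..b, f x ^ 2 * P x) - 2 * m * (∫ x in a..b, f x * P x)
        + m ^ 2 * ∫ x in a..b, P x := by
      rw [hV, ← intervalIntegral.integral_const_mul, ← intervalIntegral.integral_const_mul,
        ← intervalIntegral.integral_sub (hint _ (by fun_prop)) (hint _ (by fun_prop)),
        ← intervalIntegral.integral_add (hint _ (by fun_prop)) (hint _ (by fun_prop))]
      exact intervalIntegral.integral_congr fun x _ => by ring
    rw [h1, hm]
    field_simp
    ring
  have hνinv : (ν ^ 2)⁻¹ = ((β - α) / Real.pi) ^ 2 := by rw [hν, ← inv_pow, inv_div]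
  rw [← hVexp, ← hνinv]
  calc _ ≤ (∫ x in a..b, P x) * ((ν ^ 2)⁻¹ * ∫ x in a..b, deriv f x ^ 2 * P x) :=
        mul_le_mul_of_nonneg_left hVle I0.le
    _ = _ := by ring

/-- The Poincaré inequality on an interval with a log-concave weight `p`, in a form that does not
divide by the total mass of `p`. -/
theorem weighted_variance_le {α β : ℝ}
    {p f : ℝ → ℝ} (hp : ContinuousOn p (Set.Ioo α β)) (hp0 : ∀ x ∈ Set.Ioo α β, 0 < p x)
    (hpm : ∀ x s, x - s ∈ Set.Ioo α β → x + s ∈ Set.Ioo α β → p (x + s) * p (x - s) ≤ p x ^ 2)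
    (hpi : IntegrableOn p (Set.Ioo α β)) (hf : ContDiff ℝ 1 f) :
    (∫ x in Set.Ioo α β, p x) * (∫ x in Set.Ioo α β, f x ^ 2 * p x)
        - (∫ x in Set.Ioo α β, f x * p x) ^ 2 ≤
      ((β - α) / Real.pi) ^ 2 *
        ((∫ x in Set.Ioo α β, p x) * ∫ x in Set.Ioo α β, deriv f x ^ 2 * p x) := by
  rcases le_or_gt β α with h | hαβ
  · simp [Set.Ioo_eq_empty h.not_gt]
  have hbdd : ∀ k : ℝ → ℝ, Continuous k → IntegrableOn (fun x => k x * p x) (Set.Ioo α β) := by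
    intro k hk
    obtain ⟨A, hA⟩ := (isCompact_Icc (a := α) (b := β)).exists_bound_of_continuousOn hk.continuousOn
    refine Integrable.bdd_mul hpi hk.aestronglyMeasurable (c := A) ?_
    exact (ae_restrict_iff' measurableSet_Ioo).2
      (Filter.Eventually.of_forall fun x hx => hA x (Set.Ioo_subset_Icc_self hx))
  set l := β - α with hl
  have hl0 : 0 < l := by rw [hl]; linarith
  set a : ℕ → ℝ := fun n => α + l / (n + 3) with ha
  set b : ℕ → ℝ := fun n => β - l / (n + 3) with hb
  have hfrac : ∀ n : ℕ, 0 < l / (n + 3) ∧ l / (n + 3) ≤ l / 3 := fun n =>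
    ⟨by positivity, div_le_div_of_nonneg_left hl0.le (by norm_num) (by simp)⟩
  have hαa : ∀ n, α < a n := fun n => by have := (hfrac n).1; simp only [ha]; linarith
  have hbβ : ∀ n, b n < β := fun n => by have := (hfrac n).1; simp only [hb]; linarith
  have hab : ∀ n, a n < b n := fun n => by
    have := (hfrac n).2; simp only [ha, hb]; linarith
  have hlim0 : Filter.Tendsto (fun n : ℕ => l / ((n : ℝ) + 3)) Filter.atTop (nhds 0) :=
    Filter.Tendsto.div_atTop tendsto_const_nhds
      (Filter.tendsto_atTop_add_const_right _ _ tendsto_natCast_atTop_atTop)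
  have hunion : ⋃ n, Set.Ioc (a n) (b n) = Set.Ioo α β := by
    refine Set.Subset.antisymm (Set.iUnion_subset fun n x hx =>
      ⟨(hαa n).trans hx.1, hx.2.trans_lt (hbβ n)⟩) fun x hx => ?_
    have h1 := (hlim0.eventually (gt_mem_nhds (sub_pos.2 hx.1))).and
      (hlim0.eventually (gt_mem_nhds (sub_pos.2 hx.2)))
    obtain ⟨n, hn1, hn2⟩ := h1.exists
    exact Set.mem_iUnion.2 ⟨n, by simp only [ha]; linarith, by simp only [hb]; linarith⟩
  have hmono : Monotone fun n => Set.Ioc (a n) (b n) := fun m n hmn => by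
    have : l / ((n : ℝ) + 3) ≤ l / ((m : ℝ) + 3) :=
      div_le_div_of_nonneg_left hl0.le (by positivity) (by gcongr)
    exact Set.Ioc_subset_Ioc (by simp only [ha]; linarith) (by simp only [hb]; linarith)
  have lim : ∀ k : ℝ → ℝ, Continuous k → Filter.Tendsto (fun n => ∫ x in a n..b n, k x * p x)
      Filter.atTop (nhds (∫ x in Set.Ioo α β, k x * p x)) := fun k hk => by
    have := tendsto_setIntegral_of_monotone (μ := volume) (fun n => measurableSet_Ioc) hmono
      (f := fun x => k x * p x) (by rw [hunion]; exact hbdd k hk)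
    rw [hunion] at this
    refine this.congr fun n => ?_
    rw [intervalIntegral.integral_of_le (hab n).le]
  have lim1 : Filter.Tendsto (fun n => ∫ x in a n..b n, p x)
      Filter.atTop (nhds (∫ x in Set.Ioo α β, p x)) := by
    simpa using lim (fun _ => 1) continuous_const
  have hfc : Continuous f := hf.continuous
  have hf'c : Continuous (deriv f) := hf.continuous_deriv le_rfl
  exact le_of_tendsto_of_tendsto
    ((lim1.mul (lim (fun x => f x ^ 2) (by fun_prop))).sub ((lim f hfc).pow 2))
    ((lim1.mul (lim (fun x => deriv f x ^ 2) (by fun_prop))).const_mul _)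
    (Filter.Eventually.of_forall fun n =>
      weighted_variance_le_Icc (hαa n) (hab n) (hbβ n) hp hp0 hpm hf)

/-! ### Functions of one linear coordinate on a convex body -/

/-- The volume of the slices of a convex set is a log-concave function. -/
theorem Convex.measureReal_slice_rpow_mul_le {n : ℕ} {S : Set (ℝ × (Fin n → ℝ))}
    (hS : Convex ℝ S) (hSo : IsOpen S) (hfin : ∀ t, volume (Prod.mk t ⁻¹' S) ≠ ⊤)
    (s t : ℝ) {a b : ℝ} (ha : 0 < a) (hb : 0 < b) (hab : a + b = 1) :
    volume.real (Prod.mk s ⁻¹' S) ^ a * volume.real (Prod.mk t ⁻¹' S) ^ b ≤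
      volume.real (Prod.mk (a * s + b * t) ⁻¹' S) := by
  have ho : ∀ t, MeasurableSet (Prod.mk t ⁻¹' S) := fun t =>
    (hSo.preimage (Continuous.prodMk_right t)).measurableSet
  have key := lintegral_prekopa_leindler (n := n) ha hb hab
    (f := (Prod.mk s ⁻¹' S).indicator 1) (g := (Prod.mk t ⁻¹' S).indicator 1)
    (h := (Prod.mk (a * s + b * t) ⁻¹' S).indicator 1)
    (measurable_one.indicator (ho s)) (measurable_one.indicator (ho t))
    (measurable_one.indicator (ho _)) (fun x y => by
      by_cases hx : x ∈ Prod.mk s ⁻¹' S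
      · by_cases hy : y ∈ Prod.mk t ⁻¹' S
        · have hxy : a • x + b • y ∈ Prod.mk (a * s + b * t) ⁻¹' S := by
            simpa using hS hx hy ha.le hb.le hab
          rw [Set.indicator_of_mem hx, Set.indicator_of_mem hy, Set.indicator_of_mem hxy]
          simp
        · simp [Set.indicator_of_notMem hy, ENNReal.zero_rpow_of_pos hb]
      · simp [Set.indicator_of_notMem hx, ENNReal.zero_rpow_of_pos ha])
  rw [lintegral_indicator_one (ho _), lintegral_indicator_one (ho _),
    lintegral_indicator_one (ho _)] at key
  have := ENNReal.toReal_mono (hfin _) key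
  rwa [ENNReal.toReal_mul, ← ENNReal.toReal_rpow, ← ENNReal.toReal_rpow] at this

theorem setIntegral_comp_fst_eq_integral_mul_slice {n : ℕ} {S : Set (ℝ × (Fin n → ℝ))}
    (hSo : IsOpen S) (hSb : Bornology.IsBounded S) {f : ℝ → ℝ} (hf : Continuous f) :
    ∫ z in S, f z.1 = ∫ t, f t * volume.real (Prod.mk t ⁻¹' S) := by
  have hint : IntegrableOn (fun z : ℝ × (Fin n → ℝ) => f z.1) S :=
    ((hf.comp continuous_fst).continuousOn.integrableOn_compact
      hSb.isCompact_closure).mono_set subset_closure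
  rw [← integral_indicator hSo.measurableSet, Measure.volume_eq_prod, integral_prod]
  · congr 1; ext t
    have : (fun y : Fin n → ℝ => S.indicator (fun z : ℝ × (Fin n → ℝ) => f z.1) (t, y))
        = (Prod.mk t ⁻¹' S).indicator fun _ => f t := rfl
    rw [this, integral_indicator (hSo.preimage (Continuous.prodMk_right t)).measurableSet,
      setIntegral_const, smul_eq_mul, mul_comm]
  · rw [← Measure.volume_eq_prod]
    exact (integrable_indicator_iff hSo.measurableSet).2 hint

theorem variance_comp_fst_le {n : ℕ} {S : Set (ℝ × (Fin n → ℝ))} (hS : Convex ℝ S)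
    (hSo : IsOpen S) (hSb : Bornology.IsBounded S) {D : ℝ}
    (hD : ∀ x ∈ S, ∀ y ∈ S, x.1 - y.1 ≤ D) {f : ℝ → ℝ} (hf : ContDiff ℝ 1 f) :
    volume.real S * (∫ z in S, f z.1 ^ 2) - (∫ z in S, f z.1) ^ 2 ≤
      (D / Real.pi) ^ 2 * (volume.real S * ∫ z in S, deriv f z.1 ^ 2) := by
  rcases S.eq_empty_or_nonempty with rfl | hne
  · simp
  set p : ℝ → ℝ := fun t => volume.real (Prod.mk t ⁻¹' S) with hp
  have hslice_b : ∀ t, Bornology.IsBounded (Prod.mk t ⁻¹' S) := fun t => by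
    refine ((LipschitzWith.prod_snd.isBounded_image hSb)).subset fun y hy => ⟨(t, y), hy, rfl⟩
  have hfin : ∀ t, volume (Prod.mk t ⁻¹' S) ≠ ⊤ := fun t => (hslice_b t).measure_lt_top.ne
  set I : Set ℝ := Prod.fst '' S with hI
  have hIne : I.Nonempty := hne.image _
  have hIb : Bornology.IsBounded I := LipschitzWith.prod_fst.isBounded_image hSb
  have hIconn : IsConnected I :=
    ⟨hIne, (hS.isPreconnected).image _ continuous_fst.continuousOn⟩
  set α := sInf I with hα
  set β := sSup I with hβ
  have hsub : Set.Ioo α β ⊆ I := hIconn.Ioo_csInf_csSup_subset hIb.bddBelow hIb.bddAbove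
  have hsup : I ⊆ Set.Icc α β := fun x hx =>
    ⟨csInf_le hIb.bddBelow hx, le_csSup hIb.bddAbove hx⟩
  have hpoff : ∀ t, t ∉ Set.Icc α β → p t = 0 := fun t ht => by
    have : Prod.mk t ⁻¹' S = ∅ := Set.eq_empty_of_forall_notMem fun y hy =>
      ht (hsup ⟨(t, y), hy, rfl⟩)
    simp [hp, this]
  have hpos : ∀ t ∈ Set.Ioo α β, 0 < p t := fun t ht => by
    obtain ⟨⟨t', y⟩, hy, rfl⟩ := hsub ht
    exact ENNReal.toReal_pos ((hSo.preimage (Continuous.prodMk_right t')).measure_pos volume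
      ⟨y, hy⟩).ne' (hfin _)
  have hlc := fun s t a b ha hb hab => hS.measureReal_slice_rpow_mul_le hSo hfin s t (a := a)
    (b := b) ha hb hab
  have hcont : ContinuousOn p (Set.Ioo α β) := by
    have hconc : ConcaveOn ℝ (Set.Ioo α β) fun t => Real.log (p t) := by
      refine concaveOn_iff_forall_pos.2 ⟨convex_Ioo _ _, fun s hs t ht a b ha hb hab => ?_⟩
      have h1 := hlc s t a b ha hb hab
      have hs' := hpos s hs
      have ht' := hpos t ht
      have h2 := Real.log_le_log (mul_pos (Real.rpow_pos_of_pos hs' a)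
        (Real.rpow_pos_of_pos ht' b)) h1
      rw [Real.log_mul (Real.rpow_pos_of_pos hs' a).ne' (Real.rpow_pos_of_pos ht' b).ne',
        Real.log_rpow hs', Real.log_rpow ht'] at h2
      simpa only [smul_eq_mul] using h2
    refine (hconc.continuousOn isOpen_Ioo).rexp.congr fun t ht => ?_
    simp only [Real.exp_log (hpos t ht)]
  have hmid : ∀ x s, x - s ∈ Set.Ioo α β → x + s ∈ Set.Ioo α β →
      p (x + s) * p (x - s) ≤ p x ^ 2 := fun x s h1 h2 => by
    have h3 := hlc (x + s) (x - s) (1 / 2) (1 / 2) (by norm_num) (by norm_num) (by norm_num)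
    rw [show 1 / 2 * (x + s) + 1 / 2 * (x - s) = x by ring] at h3
    change p (x + s) ^ (1 / 2 : ℝ) * p (x - s) ^ (1 / 2 : ℝ) ≤ p x at h3
    rw [← Real.sqrt_eq_rpow, ← Real.sqrt_eq_rpow] at h3
    calc p (x + s) * p (x - s) = (√(p (x + s)) * √(p (x - s))) ^ 2 := by
          rw [mul_pow, Real.sq_sqrt (hpos _ h2).le, Real.sq_sqrt (hpos _ h1).le]
      _ ≤ p x ^ 2 := by gcongr
  have hpint : Integrable p := by
    have := Measure.integrable_measure_prodMk_left (μ := (volume : Measure ℝ))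
      (ν := (volume : Measure (Fin n → ℝ))) hSo.measurableSet
      (by rw [← Measure.volume_eq_prod]; exact hSb.measure_lt_top.ne)
    exact this
  have hint : ∀ k : ℝ → ℝ, Continuous k →
      ∫ z in S, k z.1 = ∫ t in Set.Ioo α β, k t * p t := fun k hk => by
    rw [setIntegral_comp_fst_eq_integral_mul_slice hSo hSb hk, ← integral_Icc_eq_integral_Ioo]
    exact (setIntegral_eq_integral_of_forall_compl_eq_zero fun t ht => by
      change k t * p t = 0
      rw [hpoff t ht, mul_zero]).symm
  have hvol : volume.real S = ∫ t in Set.Ioo α β, p t := by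
    simpa using hint (fun _ => 1) continuous_const
  have hfc : Continuous f := hf.continuous
  have hf'c : Continuous (deriv f) := hf.continuous_deriv le_rfl
  rw [hvol, hint (fun t => f t ^ 2) (by fun_prop), hint f hfc,
    hint (fun t => deriv f t ^ 2) (by fun_prop)]
  refine (weighted_variance_le hcont hpos hmid hpint.integrableOn hf).trans ?_
  have hαβ : α ≤ β := by
    obtain ⟨x, hx⟩ := hIne
    exact (hsup hx).1.trans (hsup hx).2
  have hβα : β - α ≤ D := by
    have h1 : β ≤ D + α := csSup_le hIne fun x hx => by
      have : x - D ≤ α := le_csInf hIne fun y hy => by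
        obtain ⟨x', hx', rfl⟩ := hx
        obtain ⟨y', hy', rfl⟩ := hy
        linarith [hD x' hx' y' hy']
      linarith
    linarith
  have h0 : 0 ≤ (∫ x in Set.Ioo α β, p x) * ∫ x in Set.Ioo α β, deriv f x ^ 2 * p x := by
    refine mul_nonneg (setIntegral_nonneg measurableSet_Ioo fun x hx => (hpos x hx).le)
      (setIntegral_nonneg measurableSet_Ioo fun x hx =>
        mul_nonneg (sq_nonneg _) (hpos x hx).le)
  refine mul_le_mul_of_nonneg_right ?_ h0
  have := Real.pi_pos
  gcongr

/-- The sharp Poincaré inequality on a convex body, for functions of one linear coordinate. -/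
theorem variance_comp_inner_le {d : ℕ} {K : Set (EuclideanSpace ℝ (Fin d))} (hK : Convex ℝ K)
    (hKo : IsOpen K) (hKb : Bornology.IsBounded K) {D : ℝ} (hD : Metric.diam K ≤ D)
    {w : EuclideanSpace ℝ (Fin d)} (hw : ‖w‖ = 1) {f : ℝ → ℝ} (hf : ContDiff ℝ 1 f) :
    volume.real K * (∫ x in K, f (inner ℝ w x) ^ 2) - (∫ x in K, f (inner ℝ w x)) ^ 2 ≤
      (D / Real.pi) ^ 2 * (volume.real K * ∫ x in K, deriv f (inner ℝ w x) ^ 2) := by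
  rcases d with _ | n
  · simp [Subsingleton.elim w 0] at hw
  obtain ⟨b, hb⟩ := Orthonormal.exists_orthonormalBasis_extension_of_card_eq (𝕜 := ℝ)
    (E := EuclideanSpace ℝ (Fin (n + 1))) (ι := Fin (n + 1)) (by simp) (v := fun _ => w)
    (s := {0}) (by
      refine ⟨fun i => by simpa using hw, fun i j hij => ?_⟩
      exact absurd (Subsingleton.elim i j) hij)
  have hb0 : b 0 = w := hb 0 rfl
  -- Coordinates in which `⟨w, ·⟩` is the first one.
  set Ψ : ℝ × (Fin n → ℝ) → EuclideanSpace ℝ (Fin (n + 1)) :=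
    fun z => b.repr.symm (WithLp.toLp 2 (Fin.cons z.1 z.2)) with hΨ
  have hrepr : ∀ z, b.repr (Ψ z) = WithLp.toLp 2 (Fin.cons z.1 z.2) := fun z => by simp [hΨ]
  have hΨ1 : ∀ z, inner ℝ w (Ψ z) = z.1 := fun z => by
    rw [← hb0, ← b.repr_apply_apply, hrepr]; simp
  have hcons : Continuous fun z : ℝ × (Fin n → ℝ) => (Fin.cons z.1 z.2 : Fin (n + 1) → ℝ) := by
    refine continuous_pi fun i => ?_
    refine Fin.cases ?_ (fun j => ?_) i <;> simp <;> fun_prop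
  have hΨc : Continuous Ψ :=
    b.repr.symm.continuous.comp ((PiLp.continuous_toLp 2 _).comp hcons)
  have hΨinj : Function.Injective Ψ := fun z z' h => by
    have h1 := congrArg (fun x => b.repr x) h
    simp only [hrepr] at h1
    have h2 : (Fin.cons z.1 z.2 : Fin (n + 1) → ℝ) = Fin.cons z'.1 z'.2 := by
      simpa using h1
    exact Prod.ext (Fin.cons_inj.1 h2).1 (Fin.cons_inj.1 h2).2
  have hΨmp : MeasurePreserving Ψ := by
    have := (b.measurePreserving_repr_symm.comp (PiLp.volume_preserving_toLp (Fin (n + 1)))).comp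
      (volume_preserving_piFinSuccAbove (fun _ : Fin (n + 1) => ℝ) 0).symm
    have e : Ψ = (b.repr.symm ∘ WithLp.toLp 2) ∘
        (MeasurableEquiv.piFinSuccAbove (fun _ : Fin (n + 1) => ℝ) 0).symm := by
      funext z
      simp [hΨ, MeasurableEquiv.piFinSuccAbove, Fin.insertNthEquiv]
    rw [e]
    exact this
  have hΨemb : MeasurableEmbedding Ψ := hΨc.measurableEmbedding hΨinj
  have hΨlin : ∀ (x y : ℝ × (Fin n → ℝ)) (s t : ℝ), Ψ (s • x + t • y) = s • Ψ x + t • Ψ y := by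
    intro x y s t
    simp only [hΨ, ← map_smul, ← map_add, ← WithLp.toLp_smul, ← WithLp.toLp_add]
    congr 2
    ext i
    refine Fin.cases ?_ (fun j => ?_) i <;> simp
  set S := Ψ ⁻¹' K with hS
  have hSc : Convex ℝ S := fun x hx y hy s t hs ht hst => by
    simp only [hS, Set.mem_preimage, hΨlin]
    exact hK hx hy hs ht hst
  have hSb : Bornology.IsBounded S := by
    obtain ⟨C, hC⟩ := isBounded_iff_forall_norm_le.1 hKb
    refine isBounded_iff_forall_norm_le.2 ⟨C, fun z hz => ?_⟩
    have h1 : ∀ i, ‖(Fin.cons z.1 z.2 : Fin (n + 1) → ℝ) i‖ ≤ C := fun i => by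
      have := PiLp.norm_apply_le (b.repr (Ψ z)) i
      rw [LinearIsometryEquiv.norm_map, hrepr] at this
      exact this.trans (hC _ hz)
    have hC0 : 0 ≤ C := (norm_nonneg _).trans (h1 0)
    refine norm_prod_le_iff.2 ⟨by simpa using h1 0, (pi_norm_le_iff_of_nonneg hC0).2 fun j => ?_⟩
    simpa using h1 j.succ
  have hint : ∀ k : ℝ → ℝ, ∫ x in K, k (inner ℝ w x) = ∫ z in S, k z.1 := fun k => by
    rw [← hΨmp.setIntegral_preimage_emb hΨemb]
    simp only [hΨ1, hS]
  have hvol : volume.real K = volume.real S := by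
    simpa using hint fun _ => 1
  rw [hvol, hint fun t => f t ^ 2, hint f, hint fun t => deriv f t ^ 2]
  refine variance_comp_fst_le hSc (hKo.preimage hΨc) hSb (fun x hx y hy => ?_) hf
  calc x.1 - y.1 = inner ℝ w (Ψ x - Ψ y) := by rw [inner_sub_right, hΨ1, hΨ1]
    _ ≤ ‖w‖ * ‖Ψ x - Ψ y‖ := real_inner_le_norm _ _
    _ ≤ D := by
      rw [hw, one_mul, ← dist_eq_norm]
      exact (Metric.dist_le_diam_of_mem hKb hx hy).trans hD

/-! ### Localization: cutting a convex body down to a needle -/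

/-- The affine function on `ℝᵈ` that vanishes on the hyperplane through the codimension two
subspace `{x | xᵢ = a, xⱼ = b}` at angle `θ`. -/
noncomputable def pencil {d : ℕ} (i j : Fin d) (a b θ : ℝ) (x : EuclideanSpace ℝ (Fin d)) : ℝ :=
  Real.cos θ * (x i - a) + Real.sin θ * (x j - b)

section pencil

variable {d : ℕ} {i j : Fin d} {a b θ : ℝ}

theorem continuous_pencil : Continuous (pencil i j a b θ) := by unfold pencil; fun_prop

theorem pencil_add_pi (x : EuclideanSpace ℝ (Fin d)) :
    pencil i j a b (θ + Real.pi) x = -pencil i j a b θ x := by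
  simp only [pencil, Real.cos_add_pi, Real.sin_add_pi]; ring

theorem pencil_combo (x y : EuclideanSpace ℝ (Fin d)) {s t : ℝ} (hst : s + t = 1) :
    pencil i j a b θ (s • x + t • y) = s * pencil i j a b θ x + t * pencil i j a b θ y := by
  simp only [pencil, PiLp.add_apply, PiLp.smul_apply, smul_eq_mul]
  obtain rfl : t = 1 - s := by linarith
  ring

theorem volume_pencil_eq_zero (hij : i ≠ j) :
    volume {x : EuclideanSpace ℝ (Fin d) | pencil i j a b θ x = 0} = 0 := by
  rcases Set.eq_empty_or_nonempty {x : EuclideanSpace ℝ (Fin d) | pencil i j a b θ x = 0}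
    with h | ⟨x₀, hx₀⟩
  · rw [h, measure_empty]
  set L : EuclideanSpace ℝ (Fin d) →ₗ[ℝ] ℝ :=
    { toFun := pencil i j 0 0 θ
      map_add' := fun x y => by simp only [pencil, PiLp.add_apply]; ring
      map_smul' := fun c x => by
        simp only [pencil, PiLp.smul_apply, smul_eq_mul, RingHom.id_apply]; ring } with hL
  have hker : LinearMap.ker L ≠ ⊤ := fun h => by
    have h1 : L (EuclideanSpace.single i 1) = 0 := by
      rw [← LinearMap.mem_ker, h]; trivial
    have h2 : L (EuclideanSpace.single j 1) = 0 := by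
      rw [← LinearMap.mem_ker, h]; trivial
    have h1' : Real.cos θ = 0 := by simpa [hL, pencil, hij, hij.symm] using h1
    have h2' : Real.sin θ = 0 := by simpa [hL, pencil, hij, hij.symm] using h2
    have := Real.sin_sq_add_cos_sq θ
    rw [h1', h2'] at this
    norm_num at this
  have e : {x : EuclideanSpace ℝ (Fin d) | pencil i j a b θ x = 0}
      = (fun x => x + -x₀) ⁻¹' (LinearMap.ker L : Set (EuclideanSpace ℝ (Fin d))) := by
    ext x
    have hx₀' : pencil i j a b θ x₀ = 0 := hx₀
    have : L (x + -x₀) = pencil i j a b θ x - pencil i j a b θ x₀ := by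
      simp only [hL, LinearMap.coe_mk, AddHom.coe_mk, pencil, PiLp.add_apply, PiLp.neg_apply]; ring
    simp only [Set.mem_ofPred_eq, Set.mem_preimage, SetLike.mem_coe, LinearMap.mem_ker, this, hx₀',
      sub_zero]
  rw [e, measure_preimage_add_right]
  exact Measure.addHaar_submodule _ _ hker

end pencil

/-- An open bounded convex set on which `g` has mean zero and `h` has negative mean. -/
structure IsNeedleCandidate {d : ℕ} (g h : EuclideanSpace ℝ (Fin d) → ℝ)
    (K : Set (EuclideanSpace ℝ (Fin d))) : Prop where
  isOpen : IsOpen K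
  convex : Convex ℝ K
  isBounded : Bornology.IsBounded K
  integral_eq_zero : ∫ x in K, g x = 0
  integral_neg : ∫ x in K, h x < 0

namespace IsNeedleCandidate

variable {d : ℕ} {g h : EuclideanSpace ℝ (Fin d) → ℝ} {K : Set (EuclideanSpace ℝ (Fin d))}

theorem nonempty (hK : IsNeedleCandidate g h K) : K.Nonempty := by
  rw [Set.nonempty_iff_ne_empty]
  rintro rfl
  simpa using hK.integral_neg

/-- Some hyperplane of the pencil cuts `K` into two halves on both of which `g` has mean zero, by
the intermediate value theorem in the angle; on one of them `h` has negative mean. -/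
theorem exists_cut (hK : IsNeedleCandidate g h K) (hg : Continuous g) (hh : Continuous h)
    {i j : Fin d} (hij : i ≠ j) (a b : ℝ) :
    ∃ K' ⊆ K, IsNeedleCandidate g h K' ∧ ∃ θ, ∀ x ∈ K', 0 ≤ pencil i j a b θ x := by
  set H : ℝ → Set (EuclideanSpace ℝ (Fin d)) := fun θ => K ∩ {x | 0 < pencil i j a b θ x} with hH
  have hHo : ∀ θ, IsOpen (H θ) := fun θ =>
    hK.isOpen.inter (isOpen_lt continuous_const continuous_pencil)
  have hint : ∀ k : EuclideanSpace ℝ (Fin d) → ℝ, Continuous k → IntegrableOn k K := fun k hk =>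
    (hk.continuousOn.integrableOn_compact hK.isBounded.isCompact_closure).mono_set subset_closure
  have hsplit : ∀ k : EuclideanSpace ℝ (Fin d) → ℝ, Continuous k → ∀ θ,
      (∫ x in H θ, k x) + ∫ x in H (θ + Real.pi), k x = ∫ x in K, k x := fun k hk θ => by
    rw [← setIntegral_union _ (hHo _).measurableSet ((hint k hk).mono_set Set.inter_subset_left)
      ((hint k hk).mono_set Set.inter_subset_left)]
    · refine setIntegral_congr_set ?_
      have h0 := measure_eq_zero_iff_ae_notMem.1
        (volume_pencil_eq_zero (a := a) (b := b) (θ := θ) hij)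
      filter_upwards [h0] with x hx
      have hx' : pencil i j a b θ x ≠ 0 := hx
      refine propext ⟨fun hx1 => hx1.elim (fun h => h.1) (fun h => h.1), fun hx1 => ?_⟩
      rcases lt_or_gt_of_ne hx' with h1 | h1
      · refine Or.inr ⟨hx1, ?_⟩
        rw [Set.mem_ofPred_eq, pencil_add_pi]
        linarith
      · exact Or.inl ⟨hx1, h1⟩
    · refine Set.disjoint_left.2 fun x hx1 hx2 => ?_
      have h1 : 0 < pencil i j a b θ x := hx1.2
      have h2 : 0 < pencil i j a b (θ + Real.pi) x := hx2.2
      rw [pencil_add_pi] at h2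
      linarith
  have hcont : Continuous fun θ => ∫ x in H θ, g x := by
    refine continuous_iff_continuousAt.2 fun θ₀ => ?_
    have e : ∀ θ, ∫ x in H θ, g x
        = ∫ x in K, {x | 0 < pencil i j a b θ x}.indicator g x := fun θ => by
      rw [setIntegral_indicator (isOpen_lt continuous_const continuous_pencil).measurableSet]
    simp only [e]
    refine tendsto_integral_filter_of_dominated_convergence (fun x => ‖g x‖) ?_ ?_
      (hint g hg).norm ?_
    · exact Filter.Eventually.of_forall fun θ => hg.aestronglyMeasurable.indicator
        (isOpen_lt continuous_const continuous_pencil).measurableSet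
    · exact Filter.Eventually.of_forall fun θ => Filter.Eventually.of_forall fun x =>
        norm_indicator_le_norm_self _ _
    · refine ae_restrict_of_ae ?_
      have h0 := measure_eq_zero_iff_ae_notMem.1
        (volume_pencil_eq_zero (a := a) (b := b) (θ := θ₀) hij)
      filter_upwards [h0] with x hx
      have hx' : pencil i j a b θ₀ x ≠ 0 := hx
      have hc : Continuous fun θ => pencil i j a b θ x := by unfold pencil; fun_prop
      refine tendsto_const_nhds.congr' ?_
      rcases lt_or_gt_of_ne hx' with h1 | h1
      · filter_upwards [hc.continuousAt.eventually (gt_mem_nhds h1)] with θ hθ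
        have hn : x ∉ {x | 0 < pencil i j a b θ x} := not_lt.2 hθ.le
        have hn₀ : x ∉ {x | 0 < pencil i j a b θ₀ x} := not_lt.2 h1.le
        rw [Set.indicator_of_notMem hn, Set.indicator_of_notMem hn₀]
      · filter_upwards [hc.continuousAt.eventually (lt_mem_nhds h1)] with θ hθ
        have hn : x ∈ {x | 0 < pencil i j a b θ x} := hθ
        have hn₀ : x ∈ {x | 0 < pencil i j a b θ₀ x} := h1
        rw [Set.indicator_of_mem hn, Set.indicator_of_mem hn₀]
  obtain ⟨θ, hθ⟩ : ∃ θ, ∫ x in H θ, g x = 0 := by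
    have h1 := hsplit g hg 0
    rw [hK.integral_eq_zero] at h1
    refine mem_range_of_exists_le_of_exists_ge hcont ?_ ?_
    · rcases le_or_gt (∫ x in H 0, g x) 0 with h2 | h2
      · exact ⟨_, h2⟩
      · exact ⟨0 + Real.pi, by linarith⟩
    · rcases le_or_gt 0 (∫ x in H 0, g x) with h2 | h2
      · exact ⟨_, h2⟩
      · exact ⟨0 + Real.pi, by linarith⟩
  have hθ' : ∫ x in H (θ + Real.pi), g x = 0 := by
    have := hsplit g hg θ
    rw [hθ, hK.integral_eq_zero] at this
    linarith
  have hcv : ∀ θ, Convex ℝ (H θ) := fun θ => hK.convex.inter fun x hx y hy s t hs ht hst => by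
    have hx' : 0 < pencil i j a b θ x := hx
    have hy' : 0 < pencil i j a b θ y := hy
    rw [Set.mem_ofPred_eq, pencil_combo x y hst]
    rcases hs.eq_or_lt with rfl | hs'
    · have : t = 1 := by linarith
      subst this
      linarith
    · have := mul_pos hs' hx'
      have := mul_nonneg ht hy'.le
      linarith
  have hgood : ∀ θ, ∫ x in H θ, g x = 0 → ∫ x in H θ, h x < 0 →
      ∃ K' ⊆ K, IsNeedleCandidate g h K' ∧ ∃ θ, ∀ x ∈ K', 0 ≤ pencil i j a b θ x :=
    fun θ h1 h2 => ⟨H θ, Set.inter_subset_left, ⟨hHo θ, hcv θ,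
      hK.isBounded.subset Set.inter_subset_left, h1, h2⟩, θ, fun x hx => le_of_lt hx.2⟩
  have hhs := hsplit h hh θ
  have hneg := hK.integral_neg
  rcases lt_or_ge (∫ x in H θ, h x) 0 with h1 | h1
  · exact hgood θ hθ h1
  · exact hgood _ hθ' (by linarith)

/-- Cutting along the pencils through all pairs of coordinates and all rational points gives a
decreasing sequence of convex bodies that no such pencil can cut any further. -/
theorem exists_antitone_seq (hK : IsNeedleCandidate g h K) (hg : Continuous g)
    (hh : Continuous h) : ∃ S : ℕ → Set (EuclideanSpace ℝ (Fin d)),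
      (∀ n, S n ⊆ K) ∧ Antitone S ∧ (∀ n, IsNeedleCandidate g h (S n)) ∧
      ∀ (i j : Fin d) (a b : ℚ), i ≠ j →
        ∃ n θ, ∀ x ∈ S n, 0 ≤ pencil i j (a : ℝ) (b : ℝ) θ x := by
  obtain ⟨e, he⟩ := exists_surjective_nat (Option (Fin d × Fin d × ℚ × ℚ))
  have step : ∀ (K : {K // IsNeedleCandidate g h K}) (o : Option (Fin d × Fin d × ℚ × ℚ)),
      ∃ K' : {K // IsNeedleCandidate g h K}, K'.1 ⊆ K.1 ∧ ∀ i j a b, o = some (i, j, a, b) →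
        i ≠ j → ∃ θ, ∀ x ∈ K'.1, 0 ≤ pencil i j (a : ℝ) (b : ℝ) θ x := by
    rintro ⟨K, hK⟩ (_ | ⟨i, j, a, b⟩)
    · exact ⟨⟨K, hK⟩, subset_rfl, by simp⟩
    · rcases eq_or_ne i j with hij | hij
      · refine ⟨⟨K, hK⟩, subset_rfl, fun i' j' a' b' h hne => ?_⟩
        simp only [Option.some.injEq, Prod.mk.injEq] at h
        exact absurd (h.1 ▸ h.2.1 ▸ hij) hne
      · obtain ⟨K', hsub, hK', hθ⟩ := hK.exists_cut hg hh hij a b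
        refine ⟨⟨K', hK'⟩, hsub, fun i' j' a' b' h _ => ?_⟩
        simp only [Option.some.injEq, Prod.mk.injEq] at h
        obtain ⟨rfl, rfl, rfl, rfl⟩ := h
        exact hθ
  choose next hsub hcut using step
  set S : ℕ → {K // IsNeedleCandidate g h K} := fun n =>
    Nat.rec ⟨K, hK⟩ (fun n K => next K (e n)) n with hS
  have hanti : Antitone fun n => (S n).1 := antitone_nat_of_succ_le fun n => hsub _ _
  refine ⟨fun n => (S n).1, fun n => hanti (Nat.zero_le n), hanti, fun n => (S n).2,
    fun i j a b hij => ?_⟩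
  obtain ⟨n, hn⟩ := he (some (i, j, a, b))
  obtain ⟨θ, hθ⟩ := hcut (S n) (e n) i j a b hn hij
  exact ⟨n + 1, θ, hθ⟩

end IsNeedleCandidate

/-- If every rational pencil has a member with `C` on one side, then `C` contains no triangle with a
nondegenerate projection to a coordinate plane: such a triangle would have a rational point in the
interior of its projection. -/
theorem minor_eq_zero_of_pencil_nonneg {d : ℕ} {C : Set (EuclideanSpace ℝ (Fin d))}
    (hC : ∀ (i j : Fin d) (a b : ℚ), i ≠ j →
      ∃ θ, ∀ x ∈ C, 0 ≤ pencil i j (a : ℝ) (b : ℝ) θ x)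
    {y₀ y₁ y₂ : EuclideanSpace ℝ (Fin d)} (h₀ : y₀ ∈ C) (h₁ : y₁ ∈ C) (h₂ : y₂ ∈ C) (i j : Fin d) :
    (y₁ i - y₀ i) * (y₂ j - y₀ j) = (y₁ j - y₀ j) * (y₂ i - y₀ i) := by
  by_contra hne
  have hij : i ≠ j := by rintro rfl; exact hne rfl
  set Δ := (y₁ i - y₀ i) * (y₂ j - y₀ j) - (y₁ j - y₀ j) * (y₂ i - y₀ i) with hΔ
  have hΔ0 : Δ ≠ 0 := sub_ne_zero.2 hne
  -- Barycentric coordinates of a point of the plane with respect to the projected triangle.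
  set s : ℝ × ℝ → ℝ := fun z =>
    ((z.1 - y₀ i) * (y₂ j - y₀ j) - (z.2 - y₀ j) * (y₂ i - y₀ i)) / Δ with hs
  set t : ℝ × ℝ → ℝ := fun z =>
    ((y₁ i - y₀ i) * (z.2 - y₀ j) - (y₁ j - y₀ j) * (z.1 - y₀ i)) / Δ with ht
  have hsc : Continuous s := by fun_prop
  have htc : Continuous t := by fun_prop
  have hU : IsOpen {z : ℝ × ℝ | 0 < s z ∧ 0 < t z ∧ s z + t z < 1} :=
    (isOpen_lt continuous_const hsc).inter ((isOpen_lt continuous_const htc).inter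
      (isOpen_lt (hsc.add htc) continuous_const))
  have hUne : {z : ℝ × ℝ | 0 < s z ∧ 0 < t z ∧ s z + t z < 1}.Nonempty := by
    refine ⟨((y₀ i + y₁ i + y₂ i) / 3, (y₀ j + y₁ j + y₂ j) / 3), ?_⟩
    have e1 : s ((y₀ i + y₁ i + y₂ i) / 3, (y₀ j + y₁ j + y₂ j) / 3) = 1 / 3 := by
      simp only [hs]; rw [div_eq_iff hΔ0, hΔ]; ring
    have e2 : t ((y₀ i + y₁ i + y₂ i) / 3, (y₀ j + y₁ j + y₂ j) / 3) = 1 / 3 := by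
      simp only [ht]; rw [div_eq_iff hΔ0, hΔ]; ring
    simp only [Set.mem_ofPred_eq, e1, e2]
    norm_num
  obtain ⟨⟨a, b⟩, hab⟩ := (Rat.denseRange_cast (𝕜 := ℝ)).prodMap
    (Rat.denseRange_cast (𝕜 := ℝ)) |>.exists_mem_open hU hUne
  obtain ⟨hs0, ht0, hst⟩ := hab
  simp only [Prod.map_apply] at hs0 ht0 hst
  obtain ⟨θ, hθ⟩ := hC i j a b hij
  have k₀ := hθ _ h₀
  have k₁ := hθ _ h₁
  have k₂ := hθ _ h₂
  set σ := s ((a : ℝ), (b : ℝ)) with hσ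
  set τ := t ((a : ℝ), (b : ℝ)) with hτ
  have ea : (a : ℝ) = y₀ i + σ * (y₁ i - y₀ i) + τ * (y₂ i - y₀ i) := by
    simp only [hσ, hτ, hs, ht]; field_simp; rw [hΔ]; ring
  have eb : (b : ℝ) = y₀ j + σ * (y₁ j - y₀ j) + τ * (y₂ j - y₀ j) := by
    simp only [hσ, hτ, hs, ht]; field_simp; rw [hΔ]; ring
  have hz : (1 - σ - τ) * pencil i j (a : ℝ) (b : ℝ) θ y₀ + σ * pencil i j (a : ℝ) (b : ℝ) θ y₁
      + τ * pencil i j (a : ℝ) (b : ℝ) θ y₂ = 0 := by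
    simp only [pencil]; rw [ea, eb]; ring
  have n₀ := mul_nonneg (by linarith : 0 ≤ 1 - σ - τ) k₀
  have n₁ := mul_nonneg hs0.le k₁
  have n₂ := mul_nonneg ht0.le k₂
  have z₀ : pencil i j (a : ℝ) (b : ℝ) θ y₀ = 0 :=
    (mul_eq_zero.1 (by linarith : (1 - σ - τ) * _ = 0)).resolve_left (by linarith)
  have z₁ : pencil i j (a : ℝ) (b : ℝ) θ y₁ = 0 :=
    (mul_eq_zero.1 (by linarith : σ * _ = 0)).resolve_left hs0.ne'
  have z₂ : pencil i j (a : ℝ) (b : ℝ) θ y₂ = 0 :=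
    (mul_eq_zero.1 (by linarith : τ * _ = 0)).resolve_left ht0.ne'
  simp only [pencil] at z₀ z₁ z₂
  have e1 : Real.cos θ * (y₁ i - y₀ i) + Real.sin θ * (y₁ j - y₀ j) = 0 := by linarith
  have e2 : Real.cos θ * (y₂ i - y₀ i) + Real.sin θ * (y₂ j - y₀ j) = 0 := by linarith
  have c1 : Real.cos θ * Δ = 0 := by
    rw [hΔ]; linear_combination (y₂ j - y₀ j) * e1 - (y₁ j - y₀ j) * e2
  have c2 : Real.sin θ * Δ = 0 := by
    rw [hΔ]; linear_combination (y₁ i - y₀ i) * e2 - (y₂ i - y₀ i) * e1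
  have c1' := (mul_eq_zero.1 c1).resolve_right hΔ0
  have c2' := (mul_eq_zero.1 c2).resolve_right hΔ0
  have := Real.sin_sq_add_cos_sq θ
  rw [c1', c2'] at this
  norm_num at this

theorem exists_eq_smul_of_minors_eq_zero {d : ℕ} {p q : EuclideanSpace ℝ (Fin d)} (hp : ‖p‖ = 1)
    (h : ∀ i j, p i * q j = p j * q i) : q = inner ℝ p q • p := by
  ext j
  have h1 : ∑ i, p i * p i = 1 := by
    have := EuclideanSpace.real_norm_sq_eq p
    rw [hp] at this
    simpa [pow_two] using this.symm
  calc q j = ∑ i, p i * p i * q j := by rw [← Finset.sum_mul, h1, one_mul]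
    _ = ∑ i, q i * p i * p j := Finset.sum_congr rfl fun i _ => by
        rw [mul_assoc, h i j]; ring
    _ = (inner ℝ p q • p) j := by
        simp [PiLp.inner_apply, Finset.sum_mul]

/-- Localization: a convex body on which `g` has mean zero and `h` has negative mean contains
convex bodies with the same property that are arbitrarily close to a line. -/
theorem IsNeedleCandidate.exists_near_line {d : ℕ} (hd : 0 < d)
    {g h : EuclideanSpace ℝ (Fin d) → ℝ} {K : Set (EuclideanSpace ℝ (Fin d))}
    (hK : IsNeedleCandidate g h K) (hg : Continuous g) (hh : Continuous h) {ε : ℝ} (hε : 0 < ε) :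
    ∃ K' ⊆ K, IsNeedleCandidate g h K' ∧ ∃ y w : EuclideanSpace ℝ (Fin d), ‖w‖ = 1 ∧
      ∀ x ∈ K', ‖x - (y + inner ℝ w (x - y) • w)‖ < ε := by
  obtain ⟨S, hSK, hanti, hS, hcut⟩ := hK.exists_antitone_seq hg hh
  set C := ⋂ n, closure (S n) with hC
  have hcpt : ∀ n, IsCompact (closure (S n)) := fun n => (hS n).isBounded.isCompact_closure
  have hdir : Directed (fun x1 x2 => x1 ⊇ x2) fun n => closure (S n) :=
    (antitone_nat_of_succ_le fun n => closure_mono (hanti (Nat.le_succ n)) :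
      Antitone fun n => closure (S n)).directed_ge
  have hCne : C.Nonempty := IsCompact.nonempty_iInter_of_directed_nonempty_isCompact_isClosed _
    hdir (fun n => (hS n).nonempty.closure) hcpt fun n => isClosed_closure
  have hCcut : ∀ (i j : Fin d) (a b : ℚ), i ≠ j →
      ∃ θ, ∀ x ∈ C, 0 ≤ pencil i j (a : ℝ) (b : ℝ) θ x := fun i j a b hij => by
    obtain ⟨n, θ, hθ⟩ := hcut i j a b hij
    refine ⟨θ, fun x hx => ?_⟩
    have hcl : closure (S n) ⊆ {x | 0 ≤ pencil i j (a : ℝ) (b : ℝ) θ x} :=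
      closure_minimal hθ (isClosed_le continuous_const continuous_pencil)
    exact hcl (Set.mem_iInter.1 hx n)
  obtain ⟨y, hy⟩ := hCne
  obtain ⟨w, hw, hCline⟩ : ∃ w : EuclideanSpace ℝ (Fin d), ‖w‖ = 1 ∧
      ∀ x ∈ C, x - y = inner ℝ w (x - y) • w := by
    by_cases hsub : ∃ y₁ ∈ C, y₁ ≠ y
    · obtain ⟨y₁, hy₁, hne⟩ := hsub
      have hn : ‖y₁ - y‖ ≠ 0 := norm_ne_zero_iff.2 (sub_ne_zero.2 hne)
      have hw1 : ‖‖y₁ - y‖⁻¹ • (y₁ - y)‖ = 1 := by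
        rw [norm_smul, norm_inv, norm_norm, inv_mul_cancel₀ hn]
      refine ⟨‖y₁ - y‖⁻¹ • (y₁ - y), hw1, fun x hx =>
        exists_eq_smul_of_minors_eq_zero hw1 fun i j => ?_⟩
      have := minor_eq_zero_of_pencil_nonneg hCcut hy hy₁ hx i j
      simp only [PiLp.smul_apply, PiLp.sub_apply, smul_eq_mul, mul_assoc, this]
    · push Not at hsub
      refine ⟨EuclideanSpace.single ⟨0, hd⟩ 1, by simp, fun x hx => ?_⟩
      simp [hsub x hx]
  have hU : IsOpen {x : EuclideanSpace ℝ (Fin d) | ‖x - (y + inner ℝ w (x - y) • w)‖ < ε} :=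
    isOpen_lt (by fun_prop) continuous_const
  obtain ⟨n, hn⟩ := exists_subset_nhds_of_isCompact hdir hcpt (U := {x |
      ‖x - (y + inner ℝ w (x - y) • w)‖ < ε}) fun x hx => hU.mem_nhds (by
    have e := hCline x hx
    have : x - (y + inner ℝ w (x - y) • w) = 0 := by rw [← e]; abel
    simpa only [Set.mem_ofPred_eq, this, norm_zero] using hε)
  exact ⟨S n, hSK n, hS n, y, w, hw, fun x hx => hn (subset_closure hx)⟩

/-! ### The Payne–Weinberger inequality -/

/-- Squaring is Lipschitz on bounded sets. -/
theorem abs_sq_sub_sq_le {a b A ρ : ℝ} (ha : |a| ≤ A) (hb : |b| ≤ A) (hab : |a - b| ≤ ρ) :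
    |a ^ 2 - b ^ 2| ≤ 2 * A * ρ := by
  have e : a ^ 2 - b ^ 2 = (a + b) * (a - b) := by ring
  rw [e, abs_mul]
  have h1 : |a + b| ≤ 2 * A := (abs_add_le a b).trans (by linarith)
  exact mul_le_mul h1 hab (abs_nonneg _) ((abs_nonneg _).trans h1)

/-- The Poincaré inequality with an error term on a convex body close to a line: there a function
of mean zero is close to a function of one linear coordinate. -/
theorem integral_sq_le_of_near_line {d : ℕ} {K : Set (EuclideanSpace ℝ (Fin d))}
    (hK : Convex ℝ K) (hKo : IsOpen K) (hKb : Bornology.IsBounded K) (hKne : K.Nonempty) {D : ℝ}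
    (hD : Metric.diam K ≤ D) {u : EuclideanSpace ℝ (Fin d) → ℝ} (hu : ContDiff ℝ 1 u)
    {A ρ η : ℝ} (hA : ∀ x, |u x| ≤ A) (hA' : ∀ x, ‖fderiv ℝ u x‖ ≤ A)
    (hρ : ∀ x y, ‖x - y‖ < η → |u x - u y| ≤ ρ)
    (hρ' : ∀ x y, ‖x - y‖ < η → ‖fderiv ℝ u x - fderiv ℝ u y‖ ≤ ρ)
    (h0 : ∫ x in K, u x = 0) {y w : EuclideanSpace ℝ (Fin d)} (hw : ‖w‖ = 1)
    (hline : ∀ x ∈ K, ‖x - (y + inner ℝ w (x - y) • w)‖ < η) :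
    ∫ x in K, u x ^ 2 ≤ (D / Real.pi) ^ 2 * (∫ x in K, ‖fderiv ℝ u x‖ ^ 2)
      + volume.real K * (2 * A * ρ + ρ ^ 2 + (D / Real.pi) ^ 2 * (2 * A * ρ)) := by
  set f : ℝ → ℝ := fun s => u (y + (s - inner ℝ w y) • w) with hf
  have hfC : ContDiff ℝ 1 f := hu.comp (by fun_prop)
  set P : EuclideanSpace ℝ (Fin d) → EuclideanSpace ℝ (Fin d) :=
    fun x => y + inner ℝ w (x - y) • w with hP
  have hfP : ∀ x, f (inner ℝ w x) = u (P x) := fun x => by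
    simp only [hf, hP, inner_sub_right]
  have hud : Differentiable ℝ u := hu.differentiable one_ne_zero
  have hderiv : ∀ x, deriv f (inner ℝ w x) = fderiv ℝ u (P x) w := fun x => by
    have h1 : HasDerivAt (fun s : ℝ => y + (s - inner ℝ w y) • w) w (inner ℝ w x) := by
      simpa using (((hasDerivAt_id (inner ℝ w x : ℝ)).sub_const (inner ℝ w y)).smul_const
        w).const_add y
    have h2 := ((hud (y + ((inner ℝ w x : ℝ) - inner ℝ w y) • w)).hasFDerivAt).comp_hasDerivAt _ h1
    rw [show P x = y + ((inner ℝ w x : ℝ) - inner ℝ w y) • w by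
      simp only [hP, inner_sub_right]]
    exact h2.deriv
  have hint : ∀ k : EuclideanSpace ℝ (Fin d) → ℝ, Continuous k → IntegrableOn k K := fun k hk =>
    (hk.continuousOn.integrableOn_compact hKb.isCompact_closure).mono_set subset_closure
  have huc : Continuous u := hu.continuous
  have hu'c : Continuous (fderiv ℝ u) := hu.continuous_fderiv one_ne_zero
  have hfc : Continuous f := hfC.continuous
  have hf'c : Continuous (deriv f) := hfC.continuous_deriv le_rfl
  have hV : 0 < volume.real K :=
    ENNReal.toReal_pos (hKo.measure_pos volume hKne).ne' hKb.measure_lt_top.ne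
  have hconst : ∀ c : ℝ, ∫ x in K, c = volume.real K * c := fun c => by simp
  have main := variance_comp_inner_le hK hKo hKb hD hw hfC
  set V := volume.real K
  have h1 : ∫ x in K, u x ^ 2 ≤ (∫ x in K, f (inner ℝ w x) ^ 2) + V * (2 * A * ρ) := by
    rw [← hconst, ← integral_add (hint _ (by fun_prop)) (hint _ (by fun_prop))]
    refine setIntegral_mono_on (hint _ (by fun_prop)) (hint _ (by fun_prop)) hKo.measurableSet
      fun x hx => ?_
    have := abs_sq_sub_sq_le (hA x) (hA (P x)) (hρ _ _ (hline x hx))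
    rw [hfP]
    linarith [le_abs_self (u x ^ 2 - u (P x) ^ 2)]
  have h2 : |∫ x in K, f (inner ℝ w x)| ≤ V * ρ := by
    have e : ∫ x in K, f (inner ℝ w x) = ∫ x in K, (f (inner ℝ w x) - u x) := by
      rw [integral_sub (hint _ (by fun_prop)) (hint _ huc), h0, sub_zero]
    rw [e, mul_comm]
    rw [← Real.norm_eq_abs]
    refine norm_setIntegral_le_of_norm_le_const (μ := volume) hKb.measure_lt_top fun x hx => ?_
    rw [hfP, Real.norm_eq_abs, abs_sub_comm]
    exact hρ _ _ (hline x hx)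
  have h3 : ∫ x in K, deriv f (inner ℝ w x) ^ 2 ≤
      (∫ x in K, ‖fderiv ℝ u x‖ ^ 2) + V * (2 * A * ρ) := by
    rw [← hconst, ← integral_add (hint _ (by fun_prop)) (hint _ (by fun_prop))]
    refine setIntegral_mono_on (hint _ (by fun_prop)) (hint _ (by fun_prop)) hKo.measurableSet
      fun x hx => ?_
    have hop : ∀ L : EuclideanSpace ℝ (Fin d) →L[ℝ] ℝ, |L w| ≤ ‖L‖ := fun L => by
      simpa [hw] using L.le_opNorm w
    have h4 := hρ' _ _ (hline x hx)
    have := abs_sq_sub_sq_le ((hop _).trans (hA' x)) ((hop _).trans (hA' (P x)))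
      ((hop (fderiv ℝ u x - fderiv ℝ u (P x))).trans h4)
    rw [hderiv]
    have h5 : fderiv ℝ u x w ^ 2 ≤ ‖fderiv ℝ u x‖ ^ 2 := sq_le_sq' (by
      linarith [neg_abs_le (fderiv ℝ u x w), hop (fderiv ℝ u x)])
      ((le_abs_self _).trans (hop _))
    linarith [neg_abs_le (fderiv ℝ u x w ^ 2 - fderiv ℝ u (P x) w ^ 2)]
  have h2' : (∫ x in K, f (inner ℝ w x)) ^ 2 ≤ (V * ρ) ^ 2 := sq_le_sq' (by
    linarith [neg_abs_le (∫ x in K, f (inner ℝ w x))]) ((le_abs_self _).trans h2)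
  have h4 : ∫ x in K, f (inner ℝ w x) ^ 2 ≤
      (D / Real.pi) ^ 2 * (∫ x in K, deriv f (inner ℝ w x) ^ 2) + V * ρ ^ 2 := by
    refine le_of_mul_le_mul_left ?_ hV
    calc V * (∫ x in K, f (inner ℝ w x) ^ 2)
        ≤ (D / Real.pi) ^ 2 * (V * ∫ x in K, deriv f (inner ℝ w x) ^ 2) + (V * ρ) ^ 2 := by
          linarith
      _ = _ := by ring
  have h5 := mul_le_mul_of_nonneg_left h3 (sq_nonneg (D / Real.pi))
  linarith

/-- The Payne–Weinberger inequality for functions of mean zero. -/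
theorem integral_sq_le_of_integral_eq_zero {d : ℕ} {K : Set (EuclideanSpace ℝ (Fin d))}
    (hK : Convex ℝ K) (hKo : IsOpen K) (hKb : Bornology.IsBounded K)
    {u : EuclideanSpace ℝ (Fin d) → ℝ} (hu : ContDiff ℝ 1 u) {A : ℝ} (hA : ∀ x, |u x| ≤ A)
    (hA' : ∀ x, ‖fderiv ℝ u x‖ ≤ A) (huu : UniformContinuous u)
    (huu' : UniformContinuous (fderiv ℝ u)) (h0 : ∫ x in K, u x = 0) :
    ∫ x in K, u x ^ 2 ≤ (Metric.diam K / Real.pi) ^ 2 * ∫ x in K, ‖fderiv ℝ u x‖ ^ 2 := by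
  set c := (Metric.diam K / Real.pi) ^ 2 with hc
  have hc0 : 0 ≤ c := sq_nonneg _
  have hA0 : 0 ≤ A := (abs_nonneg _).trans (hA 0)
  have huc : Continuous u := hu.continuous
  have hu'c : Continuous (fderiv ℝ u) := hu.continuous_fderiv one_ne_zero
  rcases K.eq_empty_or_nonempty with rfl | hKne
  · simp
  have hV : 0 < volume.real K :=
    ENNReal.toReal_pos (hKo.measure_pos volume hKne).ne' hKb.measure_lt_top.ne
  rcases d.eq_zero_or_pos with rfl | hd
  · -- In dimension zero `u` is constant.
    have hconst : ∀ x, u x = u 0 := fun x => congrArg u (Subsingleton.elim _ _)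
    simp only [hconst, setIntegral_const, smul_eq_mul] at h0
    have : u 0 = 0 := (mul_eq_zero.1 h0).resolve_left hV.ne'
    simp only [hconst, this]
    simp only [ne_eq, OfNat.ofNat_ne_zero, not_false_eq_true, zero_pow, integral_zero]
    exact mul_nonneg hc0 (integral_nonneg fun x => sq_nonneg _)
  by_contra! hlt
  set gap := (∫ x in K, u x ^ 2) - c * ∫ x in K, ‖fderiv ℝ u x‖ ^ 2 with hgap
  have hgap0 : 0 < gap := sub_pos.2 hlt
  -- `ε` uses up half of the gap, so that the integral of the candidate on `K` stays negative.
  set ε := gap / (2 * volume.real K) with hε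
  have hε0 : 0 < ε := by positivity
  have hint : ∀ L : Set (EuclideanSpace ℝ (Fin d)), Bornology.IsBounded L →
      ∀ k : EuclideanSpace ℝ (Fin d) → ℝ, Continuous k → IntegrableOn k L := fun L hL k hk =>
    (hk.continuousOn.integrableOn_compact hL.isCompact_closure).mono_set subset_closure
  have hsplit : ∀ L : Set (EuclideanSpace ℝ (Fin d)), Bornology.IsBounded L →
      ∫ x in L, (c * ‖fderiv ℝ u x‖ ^ 2 - u x ^ 2 + ε)
        = c * (∫ x in L, ‖fderiv ℝ u x‖ ^ 2) - (∫ x in L, u x ^ 2) + volume.real L * ε :=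
    fun L hL => by
    rw [integral_add (hint L hL _ (by fun_prop)) (hint L hL _ (by fun_prop)),
      integral_sub (hint L hL _ (by fun_prop)) (hint L hL _ (by fun_prop)), integral_const_mul]
    simp
  have hcand : IsNeedleCandidate u (fun x => c * ‖fderiv ℝ u x‖ ^ 2 - u x ^ 2 + ε) K := by
    refine ⟨hKo, hK, hKb, h0, ?_⟩
    rw [hsplit K hKb]
    have : volume.real K * ε = gap / 2 := by rw [hε]; field_simp
    rw [this]
    linarith
  set ρ := min 1 (ε / (2 * A + 1 + c * (2 * A))) with hρ
  have hden : 0 < 2 * A + 1 + c * (2 * A) := by positivity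
  have hρ0 : 0 < ρ := lt_min one_pos (div_pos hε0 hden)
  have hρε : 2 * A * ρ + ρ ^ 2 + c * (2 * A * ρ) ≤ ε := by
    have h1 : ρ ≤ 1 := min_le_left _ _
    have h2 : ρ * (2 * A + 1 + c * (2 * A)) ≤ ε := (le_div_iff₀ hden).1 (min_le_right _ _)
    have h3 : ρ ^ 2 ≤ ρ := by rw [pow_two]; exact mul_le_of_le_one_right hρ0.le h1
    linarith
  obtain ⟨η₁, hη₁, h₁⟩ := Metric.uniformContinuous_iff.1 huu ρ hρ0
  obtain ⟨η₂, hη₂, h₂⟩ := Metric.uniformContinuous_iff.1 huu' ρ hρ0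
  obtain ⟨L, hLK, hL, y, w, hw, hline⟩ :=
    hcand.exists_near_line hd huc (by fun_prop) (lt_min hη₁ hη₂)
  have hLb := hL.isBounded
  have key := integral_sq_le_of_near_line hL.convex hL.isOpen hLb hL.nonempty
    (Metric.diam_mono hLK hKb) hu hA hA' (ρ := ρ) (η := min η₁ η₂)
    (fun x y hxy => by
      have := h₁ (a := x) (b := y) (by rw [dist_eq_norm]; exact hxy.trans_le (min_le_left _ _))
      rw [Real.dist_eq] at this; exact this.le)
    (fun x y hxy => by
      have := h₂ (a := x) (b := y) (by rw [dist_eq_norm]; exact hxy.trans_le (min_le_right _ _))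
      rw [dist_eq_norm] at this; exact this.le)
    hL.integral_eq_zero hw hline
  have hneg := hL.integral_neg
  rw [hsplit L hLb] at hneg
  have := mul_le_mul_of_nonneg_left hρε (measureReal_nonneg (μ := volume) (s := L))
  linarith

/-- The Payne–Weinberger inequality: the optimal Poincaré constant of a bounded convex set is at
most its diameter over `π`. -/
theorem payne_weinberger {d : ℕ} {K : Set (EuclideanSpace ℝ (Fin d))}
    (hK : Convex ℝ K) (hKb : Bornology.IsBounded K)
    {φ : EuclideanSpace ℝ (Fin d) → ℝ} (hφ : ContDiff ℝ 1 φ) (hφc : HasCompactSupport φ) :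
    ∫ x in K, (φ x - ⨍ y in K, φ y) ^ 2 ≤
      (Metric.diam K / Real.pi) ^ 2 * ∫ x in K, ‖fderiv ℝ φ x‖ ^ 2 := by
  have hae : (interior K : Set (EuclideanSpace ℝ (Fin d))) =ᵐ[volume] K :=
    interior_ae_eq_of_null_frontier (hK.addHaar_frontier volume)
  set m := ⨍ y in K, φ y with hm
  have hib : Bornology.IsBounded (interior K) := hKb.subset interior_subset
  rw [← setIntegral_congr_set hae, ← setIntegral_congr_set (f := fun x => ‖fderiv ℝ φ x‖ ^ 2) hae]
  have hfd : ∀ x, fderiv ℝ (fun x => φ x - m) x = fderiv ℝ φ x := fun x => fderiv_sub_const m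
  obtain ⟨A, hA⟩ := hφc.exists_bound_of_continuous hφ.continuous
  have hφ'c := hφ.continuous_fderiv one_ne_zero
  have hφ's : HasCompactSupport (fderiv ℝ φ) := hφc.fderiv ℝ
  obtain ⟨B, hB⟩ := hφ's.exists_bound_of_continuous hφ'c
  have h0 : ∫ x in interior K, (φ x - m) = 0 := by
    rw [setIntegral_congr_set hae]
    have : IsFiniteMeasure (volume.restrict K) := ⟨by
      rw [Measure.restrict_apply_univ]; exact hKb.measure_lt_top⟩
    exact integral_sub_average (volume.restrict K) φ
  have key := integral_sq_le_of_integral_eq_zero hK.interior isOpen_interior hib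
    (u := fun x => φ x - m) (hφ.sub contDiff_const) (A := max (A + |m|) B)
    (fun x => le_max_of_le_left ((abs_sub _ _).trans (add_le_add_left (hA x) _)))
    (fun x => by rw [hfd]; exact le_max_of_le_right (hB x))
    ((hφc.uniformContinuous_of_continuous hφ.continuous).sub uniformContinuous_const)
    (by simp only [funext hfd]; exact hφ's.uniformContinuous_of_continuous hφ'c) h0
  simp only [hfd] at key
  refine key.trans (mul_le_mul_of_nonneg_right ?_ (integral_nonneg fun x => sq_nonneg _))
  have := Real.pi_pos
  have h1 := Metric.diam_mono (interior_subset : interior K ⊆ K) hKb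
  have h2 := Metric.diam_nonneg (s := interior K)
  gcongr

/-! ### From averages over data sets to the `L²`-norm -/

section LocalEstimates

variable {d : ℕ} {φ : EuclideanSpace ℝ (Fin d) → ℝ} {B K : Set (EuclideanSpace ℝ (Fin d))}

theorem integrableOn_of_continuous_of_isBounded {k : EuclideanSpace ℝ (Fin d) → ℝ}
    (hk : Continuous k) (hK : Bornology.IsBounded K) : IntegrableOn k K :=
  (hk.continuousOn.integrableOn_compact hK.isCompact_closure).mono_set subset_closure

theorem integral_sub_const_sq_eq (hφ : Continuous φ) (hK : Bornology.IsBounded K)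
    (hV : 0 < volume.real K) (c : ℝ) :
    ∫ x in K, (φ x - c) ^ 2 = (∫ x in K, (φ x - ⨍ y in K, φ y) ^ 2)
      + volume.real K * ((⨍ y in K, φ y) - c) ^ 2 := by
  have expand : ∀ c : ℝ, ∫ x in K, (φ x - c) ^ 2
      = (∫ x in K, φ x ^ 2) - 2 * c * (∫ x in K, φ x) + volume.real K * c ^ 2 := fun c => by
    have e : ∀ x, (φ x - c) ^ 2 = φ x ^ 2 - 2 * c * φ x + c ^ 2 := fun x => by ring
    simp only [e]
    rw [integral_add (integrableOn_of_continuous_of_isBounded (by fun_prop) hK)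
      (integrableOn_of_continuous_of_isBounded (by fun_prop) hK),
      integral_sub (integrableOn_of_continuous_of_isBounded (by fun_prop) hK)
      (integrableOn_of_continuous_of_isBounded (by fun_prop) hK), integral_const_mul]
    simp
  have hm : ∫ x in K, φ x = volume.real K * ⨍ y in K, φ y := by
    rw [setAverage_eq, smul_eq_mul, mul_inv_cancel_left₀ hV.ne']
  rw [expand, expand, hm]
  ring

theorem integral_sq_le_add_average_sq (hK : Convex ℝ K) (hKb : Bornology.IsBounded K)
    (hV : 0 < volume.real K) {R : ℝ} (hR : Metric.diam K ≤ R) (hφ : ContDiff ℝ 1 φ)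
    (hφc : HasCompactSupport φ) :
    ∫ x in K, φ x ^ 2 ≤ R ^ 2 / Real.pi ^ 2 * (∫ x in K, ‖fderiv ℝ φ x‖ ^ 2)
      + volume.real K * (⨍ x in K, φ x) ^ 2 := by
  have h1 := payne_weinberger hK hKb hφ hφc
  have h2 := integral_sub_const_sq_eq hφ.continuous hKb hV 0
  simp only [sub_zero] at h2
  have h3 : (Metric.diam K / Real.pi) ^ 2 ≤ R ^ 2 / Real.pi ^ 2 := by
    rw [← div_pow]
    have := Real.pi_pos
    have := Metric.diam_nonneg (s := K)
    gcongr
  have h4 := mul_le_mul_of_nonneg_right h3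
    (integral_nonneg fun x => sq_nonneg _ : 0 ≤ ∫ x in K, ‖fderiv ℝ φ x‖ ^ 2)
  linarith

/-- Replacing the average over `K` by the average over a subset `B` costs a factor
`3 |K| / |B|`. -/
theorem integral_sq_le_mul_add_average_sq (hK : Convex ℝ K) (hKb : Bornology.IsBounded K)
    (hBK : B ⊆ K) (hV : 0 < volume.real B) {R : ℝ} (hR : Metric.diam K ≤ R)
    (hφ : ContDiff ℝ 1 φ) (hφc : HasCompactSupport φ) :
    ∫ x in K, φ x ^ 2 ≤ 3 * (volume.real K / volume.real B) *
      (R ^ 2 / Real.pi ^ 2 * (∫ x in K, ‖fderiv ℝ φ x‖ ^ 2)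
        + volume.real B * (⨍ x in B, φ x) ^ 2) := by
  have hVle : volume.real B ≤ volume.real K := measureReal_mono hBK hKb.measure_lt_top.ne
  have hVK : 0 < volume.real K := hV.trans_le hVle
  have hφ0 := hφ.continuous
  set m := ⨍ x in K, φ x with hm
  set n := ⨍ x in B, φ x with hn
  set X := ∫ x in K, (φ x - m) ^ 2 with hX
  have hX0 : 0 ≤ X := integral_nonneg fun x => sq_nonneg _
  have h1 : ∫ x in K, φ x ^ 2 = X + volume.real K * m ^ 2 := by
    simpa using integral_sub_const_sq_eq hφ0 hKb hVK 0
  have h2 : X ≤ R ^ 2 / Real.pi ^ 2 * ∫ x in K, ‖fderiv ℝ φ x‖ ^ 2 := by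
    have := integral_sq_le_add_average_sq hK hKb hVK hR hφ hφc
    rw [h1] at this
    linarith
  have h3 : volume.real B * (n - m) ^ 2 ≤ X := by
    have h4 : ∫ x in B, (φ x - m) ^ 2 ≤ X :=
      setIntegral_mono_set (integrableOn_of_continuous_of_isBounded (by fun_prop) hKb)
        (Filter.Eventually.of_forall fun x => sq_nonneg _) hBK.eventuallyLE
    rw [integral_sub_const_sq_eq hφ0 (hKb.subset hBK) hV m] at h4
    have : 0 ≤ ∫ x in B, (φ x - n) ^ 2 := integral_nonneg fun x => sq_nonneg _
    linarith
  set κ := volume.real K / volume.real B with hκ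
  have hκ1 : 1 ≤ κ := (one_le_div hV).2 hVle
  have hVκ : volume.real K = κ * volume.real B := by rw [hκ, div_mul_cancel₀ _ hV.ne']
  -- Young's inequality for `m = n + (m - n)`, with the weights `3` and `3 / 2`.
  have hyoung : m ^ 2 ≤ 3 * n ^ 2 + 3 / 2 * (n - m) ^ 2 := by
    nlinarith [sq_nonneg (3 * n - m)]
  rw [h1, hVκ]
  calc X + κ * volume.real B * m ^ 2
      ≤ X + κ * volume.real B * (3 * n ^ 2 + 3 / 2 * (n - m) ^ 2) := by gcongr
    _ = X + 3 / 2 * κ * (volume.real B * (n - m) ^ 2) + 3 * κ * (volume.real B * n ^ 2) := by ring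
    _ ≤ κ * X * (3 / 2) + 3 / 2 * κ * X + 3 * κ * (volume.real B * n ^ 2) := by
        have h5 : X ≤ κ * X := le_mul_of_one_le_left hX0 hκ1
        have h6 : 0 ≤ κ * X := by positivity
        gcongr
        linarith
    _ = 3 * κ * (X + volume.real B * n ^ 2) := by ring
    _ ≤ _ := by gcongr

end LocalEstimates

namespace DataSets

variable {d m : ℕ} {Ω : Set (EuclideanSpace ℝ (Fin d))} (D : DataSets Ω m)

theorem volume_real_B_pos (i : Fin m) : 0 < volume.real (D.B i) :=
  ENNReal.toReal_pos ((D.isOpen_B i).measure_pos volume (D.nonempty_B i)).ne' (D.volume_B_ne_top i)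

theorem diam_le_radius (i : Fin m) : Metric.diam (D.K i) ≤ D.radius :=
  le_ciSup (Set.finite_range fun i => Metric.diam (D.K i)).bddAbove i

theorem mismatch_nonneg : 0 ≤ D.mismatch := by
  unfold mismatch
  split_ifs
  · exact zero_le_one
  · exact mul_nonneg (by norm_num) (Real.iSup_nonneg fun i => by positivity)

theorem ncard_le_overlap {x : EuclideanSpace ℝ (Fin d)} (hx : x ∈ Ω) :
    {i | x ∈ D.K i}.ncard ≤ D.overlap := by
  refine le_ciSup (f := fun x : Ω => {i | (x : EuclideanSpace ℝ (Fin d)) ∈ D.K i}.ncard)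
    ⟨m, ?_⟩ ⟨x, hx⟩
  rintro _ ⟨x, rfl⟩
  simpa using Set.ncard_le_card {i | (x : EuclideanSpace ℝ (Fin d)) ∈ D.K i}

theorem interior_K_ae_eq (i : Fin m) :
    (interior (D.K i) : Set (EuclideanSpace ℝ (Fin d))) =ᵐ[volume] D.K i :=
  interior_ae_eq_of_null_frontier ((D.convex_K i).addHaar_frontier volume)

theorem setIntegral_K_sq_le {φ : EuclideanSpace ℝ (Fin d) → ℝ} (hφ : ContDiff ℝ 1 φ)
    (hφc : HasCompactSupport φ) (i : Fin m) :
    ∫ x in D.K i, φ x ^ 2 ≤ D.mismatch * (D.radius ^ 2 / Real.pi ^ 2 *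
      (∫ x in D.K i, ‖fderiv ℝ φ x‖ ^ 2) + volume.real (D.B i) * (⨍ x in D.B i, φ x) ^ 2) := by
  have hV := D.volume_real_B_pos i
  unfold mismatch
  split_ifs with h
  · rw [h i] at hV ⊢
    rw [one_mul]
    exact integral_sq_le_add_average_sq (D.convex_K i) (D.bounded_K i) hV (D.diam_le_radius i)
      hφ hφc
  · refine (integral_sq_le_mul_add_average_sq (D.convex_K i) (D.bounded_K i) (D.B_subset_K i) hV
      (D.diam_le_radius i) hφ hφc).trans (mul_le_mul_of_nonneg_right ?_ ?_)
    · exact mul_le_mul_of_nonneg_left (le_ciSup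
        (Set.finite_range fun i => volume.real (D.K i) / volume.real (D.B i)).bddAbove i)
        (by norm_num)
    · have : 0 ≤ ∫ x in D.K i, ‖fderiv ℝ φ x‖ ^ 2 := integral_nonneg fun x => sq_nonneg _
      positivity

/-- The sets `Kᵢ` cover `Ω` up to their frontiers, which are null sets by convexity. -/
theorem setIntegral_le_sum_setIntegral_K {k : EuclideanSpace ℝ (Fin d) → ℝ} (hΩ : IsOpen Ω)
    (hk : Integrable k) (hk0 : ∀ x, 0 ≤ k x) :
    ∫ x in Ω, k x ≤ ∑ i, ∫ x in D.K i, k x := by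
  have hi : ∀ i, Integrable ((interior (D.K i)).indicator k) := fun i =>
    hk.indicator isOpen_interior.measurableSet
  have e : ∀ i, ∫ x in D.K i, k x = ∫ x, (interior (D.K i)).indicator k x := fun i => by
    rw [integral_indicator isOpen_interior.measurableSet,
      setIntegral_congr_set (D.interior_K_ae_eq i)]
  simp only [e]
  rw [← integral_finsetSum _ fun i _ => hi i, ← integral_indicator hΩ.measurableSet]
  refine integral_mono_ae (hk.indicator hΩ.measurableSet)
    (integrable_finsetSum _ fun i _ => hi i) ?_
  have hfr : ∀ᵐ x : EuclideanSpace ℝ (Fin d), ∀ i, x ∉ frontier (D.K i) :=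
    ae_all_iff.2 fun i => measure_eq_zero_iff_ae_notMem.1 ((D.convex_K i).addHaar_frontier volume)
  filter_upwards [hfr] with x hx
  have hnn : ∀ i ∈ Finset.univ, 0 ≤ (interior (D.K i)).indicator k x := fun i _ =>
    Set.indicator_nonneg (fun x _ => hk0 x) x
  by_cases hxΩ : x ∈ Ω
  · obtain ⟨i, hi⟩ := Set.mem_iUnion.1 (D.cover hxΩ)
    have hint : x ∈ interior (D.K i) := by
      by_contra hn
      exact hx i ⟨hi, hn⟩
    rw [Set.indicator_of_mem hxΩ]
    calc k x = (interior (D.K i)).indicator k x := (Set.indicator_of_mem hint k).symm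
      _ ≤ _ := Finset.single_le_sum hnn (Finset.mem_univ i)
  · rw [Set.indicator_of_notMem hxΩ]
    exact Finset.sum_nonneg hnn

theorem sum_setIntegral_K_le {k : EuclideanSpace ℝ (Fin d) → ℝ} (hk : Integrable k)
    (hk0 : ∀ x, 0 ≤ k x) (hkΩ : ∀ x ∉ Ω, k x = 0) :
    ∑ i, ∫ x in D.K i, k x ≤ D.overlap * ∫ x in Ω, k x := by
  have hi : ∀ i, Integrable ((interior (D.K i)).indicator k) := fun i =>
    hk.indicator isOpen_interior.measurableSet
  have e : ∀ i, ∫ x in D.K i, k x = ∫ x, (interior (D.K i)).indicator k x := fun i => by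
    rw [integral_indicator isOpen_interior.measurableSet,
      setIntegral_congr_set (D.interior_K_ae_eq i)]
  simp only [e]
  rw [← integral_finsetSum _ fun i _ => hi i,
    setIntegral_eq_integral_of_forall_compl_eq_zero hkΩ, ← integral_const_mul]
  refine integral_mono (integrable_finsetSum _ fun i _ => hi i) (hk.const_mul _) fun x => ?_
  classical
  by_cases hxΩ : x ∈ Ω
  · calc ∑ i, (interior (D.K i)).indicator k x
        ≤ ∑ i, if x ∈ D.K i then k x else 0 := Finset.sum_le_sum fun i _ => by
          rw [Set.indicator_apply]
          split_ifs with h1 h2 h2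
          · exact le_rfl
          · exact absurd (interior_subset h1) h2
          · exact hk0 x
          · exact le_rfl
      _ = ({i | x ∈ D.K i}.ncard : ℝ) * k x := by
          rw [← Finset.sum_filter, Finset.sum_const, nsmul_eq_mul, ← Set.ncard_coe_finset]
          simp
      _ ≤ D.overlap * k x :=
          mul_le_mul_of_nonneg_right (by exact_mod_cast D.ncard_le_overlap hxΩ) (hk0 x)
  · have h0 : ∀ i, (interior (D.K i)).indicator k x = 0 := fun i => by
      rw [Set.indicator_apply, hkΩ x hxΩ, ite_self]
    simp [h0, hkΩ x hxΩ]

/-- The Poincaré-type inequality of the data term, for test functions. -/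
theorem setIntegral_sq_le {φ : EuclideanSpace ℝ (Fin d) → ℝ} (hΩ : IsOpen Ω)
    (hφ : IsTestFunction Ω φ) :
    ∫ x in Ω, φ x ^ 2 ≤ D.mismatch * (D.radius ^ 2 * D.overlap / Real.pi ^ 2 *
      (∫ x in Ω, ‖fderiv ℝ φ x‖ ^ 2) + ∑ i, volume.real (D.B i) * (⨍ x in D.B i, φ x) ^ 2) := by
  have hφ1 : ContDiff ℝ 1 φ := hφ.smooth.of_le (by exact_mod_cast le_top)
  have hφ' : Continuous (fderiv ℝ φ) := hφ1.continuous_fderiv one_ne_zero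
  have hi1 : Integrable fun x => φ x ^ 2 :=
    Continuous.integrable_of_hasCompactSupport (hφ.smooth.continuous.pow 2)
      (hφ.compact.comp_left (g := fun y => y ^ 2) (by simp))
  have hi2 : Integrable fun x => ‖fderiv ℝ φ x‖ ^ 2 :=
    Continuous.integrable_of_hasCompactSupport (by fun_prop)
      ((hφ.compact.fderiv ℝ).comp_left (g := fun L => ‖L‖ ^ 2) (by simp))
  have hoff : ∀ x ∉ Ω, ‖fderiv ℝ φ x‖ ^ 2 = 0 := fun x hx => by
    have : fderiv ℝ φ x = 0 := image_eq_zero_of_notMem_tsupport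
      fun h => hx (hφ.support (tsupport_fderiv_subset ℝ h))
    simp [this]
  calc ∫ x in Ω, φ x ^ 2 ≤ ∑ i, ∫ x in D.K i, φ x ^ 2 :=
        D.setIntegral_le_sum_setIntegral_K hΩ hi1 fun x => sq_nonneg _
    _ ≤ ∑ i, D.mismatch * (D.radius ^ 2 / Real.pi ^ 2 * (∫ x in D.K i, ‖fderiv ℝ φ x‖ ^ 2)
          + volume.real (D.B i) * (⨍ x in D.B i, φ x) ^ 2) :=
        Finset.sum_le_sum fun i _ => D.setIntegral_K_sq_le hφ1 hφ.compact i
    _ = D.mismatch * (D.radius ^ 2 / Real.pi ^ 2 * (∑ i, ∫ x in D.K i, ‖fderiv ℝ φ x‖ ^ 2)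
          + ∑ i, volume.real (D.B i) * (⨍ x in D.B i, φ x) ^ 2) := by
        rw [← Finset.mul_sum, Finset.sum_add_distrib, ← Finset.mul_sum]
    _ ≤ D.mismatch * (D.radius ^ 2 / Real.pi ^ 2 * (D.overlap * ∫ x in Ω, ‖fderiv ℝ φ x‖ ^ 2)
          + ∑ i, volume.real (D.B i) * (⨍ x in D.B i, φ x) ^ 2) := by
        have := D.mismatch_nonneg
        gcongr
        exact D.sum_setIntegral_K_le hi2 (fun x => sq_nonneg _) hoff
    _ = _ := by ring

end DataSets

/-! ### Weak derivatives and `H¹₀` -/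

section Sobolev

variable {d : ℕ} {Ω : Set (EuclideanSpace ℝ (Fin d))}

theorem IsTestFunction.continuous_partial {φ : EuclideanSpace ℝ (Fin d) → ℝ}
    (hφ : IsTestFunction Ω φ) (i : Fin d) :
    Continuous fun x => fderiv ℝ φ x (EuclideanSpace.single i 1) :=
  (hφ.smooth.continuous_fderiv (by simp)).clm_apply continuous_const

theorem IsTestFunction.hasCompactSupport_partial {φ : EuclideanSpace ℝ (Fin d) → ℝ}
    (hφ : IsTestFunction Ω φ) (i : Fin d) :
    HasCompactSupport fun x => fderiv ℝ φ x (EuclideanSpace.single i 1) :=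
  (hφ.compact.fderiv ℝ).comp_left 
    (g := fun L : EuclideanSpace ℝ (Fin d) →L[ℝ] ℝ => L (EuclideanSpace.single i 1)) (by simp)

theorem integrable_L2_mul {k : EuclideanSpace ℝ (Fin d) → ℝ} (hk : Continuous k)
    (hkc : HasCompactSupport k) (v : L2 Ω) :
    Integrable (fun x => v x * k x) (volume.restrict Ω) :=
  MemLp.integrable_mul (p := 2) (q := 2) (Lp.memLp v)
    ((hk.memLp_of_hasCompactSupport hkc).restrict Ω)

theorem HasWeakPartial.sub {i : Fin d} {u v g h : L2 Ω} (hu : HasWeakPartial i u g)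
    (hv : HasWeakPartial i v h) : HasWeakPartial i (u - v) (g - h) := by
  intro φ hφ
  have aux : ∀ (a b : L2 Ω) (k : EuclideanSpace ℝ (Fin d) → ℝ), Continuous k →
      HasCompactSupport k → ∫ x in Ω, (a - b : L2 Ω) x * k x
        = (∫ x in Ω, a x * k x) - ∫ x in Ω, b x * k x := fun a b k hk hkc => by
    rw [← integral_sub (integrable_L2_mul hk hkc a) (integrable_L2_mul hk hkc b)]
    refine integral_congr_ae ?_
    filter_upwards [Lp.coeFn_sub a b] with x hx
    rw [hx, Pi.sub_apply, sub_mul]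
  rw [aux _ _ _ (hφ.continuous_partial i) (hφ.hasCompactSupport_partial i),
    aux _ _ _ hφ.smooth.continuous hφ.compact, hu φ hφ, hv φ hφ]
  ring

theorem hasWeakPartial_weakPartial {i : Fin d} {u : L2 Ω} (hu : u ∈ H1 Ω) :
    HasWeakPartial i u (weakPartial i u) := by
  unfold weakPartial
  rw [dif_pos (hu i)]
  exact (hu i).choose_spec

theorem HasWeakPartial.weakPartial_eq (hΩ : IsOpen Ω) {i : Fin d} {u g : L2 Ω}
    (h : HasWeakPartial i u g) : weakPartial i u = g := by
  have hex : ∃ g, HasWeakPartial i u g := ⟨g, h⟩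
  unfold weakPartial
  rw [dif_pos hex]
  exact HasWeakPartial.unique hΩ hex.choose_spec h

theorem weakPartial_sub (hΩ : IsOpen Ω) (i : Fin d) {u v : L2 Ω} (hu : u ∈ H1 Ω) (hv : v ∈ H1 Ω) :
    weakPartial i (u - v) = weakPartial i u - weakPartial i v :=
  ((hasWeakPartial_weakPartial hu).sub (hasWeakPartial_weakPartial hv)).weakPartial_eq hΩ

/-- The classical partial derivatives of a test function are weak ones. -/
theorem IsTestFunction.hasWeakPartial {φ : EuclideanSpace ℝ (Fin d) → ℝ}
    (hφ : IsTestFunction Ω φ) {w : L2 Ω} (hw : w =ᵐ[volume.restrict Ω] φ) (i : Fin d) :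
    HasWeakPartial i w ((((hφ.continuous_partial i).memLp_of_hasCompactSupport
      (hφ.hasCompactSupport_partial i)).restrict Ω).toLp _) := by
  intro ψ hψ
  have hint : ∀ k l : EuclideanSpace ℝ (Fin d) → ℝ, Continuous k → Continuous l →
      HasCompactSupport k → Integrable fun x => k x * l x := fun k l hk hl hkc =>
    (hk.mul hl).integrable_of_hasCompactSupport hkc.mul_right
  have e1 : ∫ x in Ω, w x * fderiv ℝ ψ x (EuclideanSpace.single i 1)
      = ∫ x, φ x * fderiv ℝ ψ x (EuclideanSpace.single i 1) := by
    refine Eq.trans (integral_congr_ae ?_)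
      (setIntegral_eq_integral_of_forall_compl_eq_zero (s := Ω) fun x hx => by
        rw [image_eq_zero_of_notMem_tsupport fun h => hx (hφ.support h), zero_mul])
    filter_upwards [hw] with x hx
    rw [hx]
  rw [e1, integral_mul_fderiv_eq_neg_fderiv_mul_of_integrable
    (hint _ _ (hφ.continuous_partial i) hψ.smooth.continuous (hφ.hasCompactSupport_partial i))
    (hint _ _ hφ.smooth.continuous (hψ.continuous_partial i) hφ.compact)
    (hint _ _ hφ.smooth.continuous hψ.smooth.continuous hφ.compact)
    (fun x _ => hφ.smooth.differentiable (by simp) x)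
    (fun x _ => hψ.smooth.differentiable (by simp) x),
    ← setIntegral_eq_integral_of_forall_compl_eq_zero (s := Ω) fun x hx => by
      rw [image_eq_zero_of_notMem_tsupport fun h => hx (hψ.support h), mul_zero]]
  congr 1
  refine integral_congr_ae ?_
  filter_upwards [MemLp.coeFn_toLp (((hφ.continuous_partial i).memLp_of_hasCompactSupport
      (p := 2) (μ := volume) (hφ.hasCompactSupport_partial i)).restrict Ω)] with x hx
  rw [hx]

theorem IsTestFunction.mem_H1 {φ : EuclideanSpace ℝ (Fin d) → ℝ}
    (hφ : IsTestFunction Ω φ) {w : L2 Ω} (hw : w =ᵐ[volume.restrict Ω] φ) : w ∈ H1 Ω :=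
  fun i => ⟨_, hφ.hasWeakPartial hw i⟩

theorem IsTestFunction.weakPartial_ae_eq (hΩ : IsOpen Ω) {φ : EuclideanSpace ℝ (Fin d) → ℝ}
    (hφ : IsTestFunction Ω φ) {w : L2 Ω} (hw : w =ᵐ[volume.restrict Ω] φ) (i : Fin d) :
    weakPartial i w =ᵐ[volume.restrict Ω] fun x => fderiv ℝ φ x (EuclideanSpace.single i 1) := by
  rw [(hφ.hasWeakPartial hw i).weakPartial_eq hΩ]
  exact MemLp.coeFn_toLp _

theorem norm_le_H1norm (u : L2 Ω) : ‖u‖ ≤ H1norm u :=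
  Real.le_sqrt_of_sq_le (le_add_of_nonneg_right (Finset.sum_nonneg fun _ _ => sq_nonneg _))

theorem norm_weakPartial_le_H1norm (i : Fin d) (u : L2 Ω) : ‖weakPartial i u‖ ≤ H1norm u := by
  refine Real.le_sqrt_of_sq_le ?_
  have h1 : ‖weakPartial i u‖ ^ 2 ≤ ∑ i, ‖weakPartial i u‖ ^ 2 :=
    Finset.single_le_sum (f := fun i => ‖weakPartial i u‖ ^ 2) (fun i _ => sq_nonneg _)
      (Finset.mem_univ i)
  exact h1.trans (le_add_of_nonneg_left (sq_nonneg _))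

/-- An element of `H¹₀` is the limit of test functions, together with its weak derivatives. -/
theorem exists_seq_tendsto_of_mem_H10 (hΩ : IsOpen Ω) {u : L2 Ω} (hu : u ∈ H10 Ω) :
    ∃ (w : ℕ → L2 Ω) (φ : ℕ → EuclideanSpace ℝ (Fin d) → ℝ), (∀ n, IsTestFunction Ω (φ n)) ∧
      (∀ n, w n =ᵐ[volume.restrict Ω] φ n) ∧ Filter.Tendsto w Filter.atTop (nhds u) ∧
      ∀ i, Filter.Tendsto (fun n => weakPartial i (w n)) Filter.atTop (nhds (weakPartial i u)) := by
  have h := fun n : ℕ => hu.2 (1 / ((n : ℝ) + 1)) (by positivity)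
  choose w hw hlt using h
  choose φ hφ hwφ using hw
  have hlim : ∀ (v : ℕ → L2 Ω) (v₀ : L2 Ω), (∀ n, ‖v₀ - v n‖ ≤ H1norm (u - w n)) →
      Filter.Tendsto v Filter.atTop (nhds v₀) := fun v v₀ hv => by
    rw [tendsto_iff_norm_sub_tendsto_zero]
    refine squeeze_zero (fun n => norm_nonneg _) (fun n => ?_)
      tendsto_one_div_add_atTop_nhds_zero_nat
    rw [norm_sub_rev]
    exact (hv n).trans (hlt n).le
  refine ⟨w, φ, hφ, hwφ, hlim _ _ fun n => norm_le_H1norm _, fun i => hlim _ _ fun n => ?_⟩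
  rw [← weakPartial_sub hΩ i hu.1 ((hφ n).mem_H1 (hwφ n))]
  exact norm_weakPartial_le_H1norm _ _

/-- Green's formula `∫ ∇u · ∇v = -∫ Δu v` for `u ∈ H²` and `v ∈ H¹₀`. -/
theorem sum_inner_weakPartial_eq_neg_inner_weakLaplacian (hΩ : IsOpen Ω) {u v : L2 Ω}
    (hu : u ∈ H2 Ω) (hv : v ∈ H10 Ω) :
    ∑ i, inner ℝ (weakPartial i u) (weakPartial i v) = -inner ℝ (weakLaplacian u) v := by
  obtain ⟨w, φ, hφ, hwφ, hw, hw'⟩ := exists_seq_tendsto_of_mem_H10 hΩ hv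
  refine tendsto_nhds_unique
    (tendsto_finsetSum _ fun i _ => tendsto_const_nhds.inner (𝕜 := ℝ) (hw' i))
    (Filter.Tendsto.congr (fun n => ?_) (tendsto_const_nhds.inner (𝕜 := ℝ) hw).neg)
  rw [weakLaplacian, sum_inner, ← Finset.sum_neg_distrib]
  refine Finset.sum_congr rfl fun i _ => ?_
  have h1 := hasWeakPartial_weakPartial (i := i) (hu.2 i) (φ n) (hφ n)
  rw [L2.inner_def, L2.inner_def]
  have e1 : ∫ x in Ω, inner ℝ (weakPartial i u x) (weakPartial i (w n) x)
      = ∫ x in Ω, weakPartial i u x * fderiv ℝ (φ n) x (EuclideanSpace.single i 1) := by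
    refine integral_congr_ae ?_
    filter_upwards [(hφ n).weakPartial_ae_eq hΩ (hwφ n) i] with x hx
    rw [hx]
    simp [mul_comm]
  have e2 : ∫ x in Ω, inner ℝ (weakPartial i (weakPartial i u) x) (w n x)
      = ∫ x in Ω, weakPartial i (weakPartial i u) x * φ n x := by
    refine integral_congr_ae ?_
    filter_upwards [hwφ n] with x hx
    rw [hx]
    simp [mul_comm]
  rw [e1, e2, h1]

theorem norm_sq_eq_setIntegral {v : L2 Ω} {k : EuclideanSpace ℝ (Fin d) → ℝ}
    (h : v =ᵐ[volume.restrict Ω] k) : ‖v‖ ^ 2 = ∫ x in Ω, k x ^ 2 := by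
  rw [← real_inner_self_eq_norm_sq, L2.inner_def]
  refine integral_congr_ae ?_
  filter_upwards [h] with x hx
  rw [hx]
  simp [pow_two]

theorem norm_sq_eq_sum_sq_apply_single (L : EuclideanSpace ℝ (Fin d) →L[ℝ] ℝ) :
    ‖L‖ ^ 2 = ∑ i, L (EuclideanSpace.single i 1) ^ 2 := by
  set v := (InnerProductSpace.toDual ℝ (EuclideanSpace ℝ (Fin d))).symm L with hv
  have h1 : ‖L‖ = ‖v‖ := by rw [hv, LinearIsometryEquiv.norm_map]
  rw [h1, EuclideanSpace.real_norm_sq_eq]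
  refine Finset.sum_congr rfl fun i _ => ?_
  have : L (EuclideanSpace.single i 1) = inner ℝ v (EuclideanSpace.single i 1) := by
    rw [hv, InnerProductSpace.toDual_symm_apply]
  rw [this, EuclideanSpace.inner_single_right]
  simp

theorem pdeForm_one_zero (w v : L2 Ω) :
    pdeForm (fun _ => 1) (fun _ => 0) w v
      = ∑ i, inner ℝ (weakPartial i w) (weakPartial i v) := by
  simp only [pdeForm, one_mul, zero_mul, add_zero, L2.inner_def]
  rw [← integral_finsetSum _ fun i _ => L2.integrable_inner (𝕜 := ℝ) _ _]
  congr 1; ext x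
  refine Finset.sum_congr rfl fun i _ => ?_
  simp [mul_comm]

theorem pdeLoad_zero (v : L2 Ω) : pdeLoad 0 v = 0 := by
  unfold pdeLoad
  rw [integral_congr_ae (g := fun _ => 0), integral_zero]
  filter_upwards [Lp.coeFn_zero ℝ 2 (volume.restrict Ω)] with x hx
  rw [hx]; simp

end Sobolev

namespace DataSets

variable {d m : ℕ} {Ω : Set (EuclideanSpace ℝ (Fin d))} (D : DataSets Ω m)

theorem dataForm_sub (w v : L2 Ω) : D.dataForm (w - v) = D.dataForm w - D.dataForm v := by
  ext z
  have h : ∀ i, ⨍ x in D.B i, (w - v : L2 Ω) x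
      = (⨍ x in D.B i, w x) - ⨍ x in D.B i, v x := fun i => map_sub (D.averageCLM i) w v
  simp only [sub_apply, D.dataForm_apply, h, mul_sub, sub_mul,
    Finset.sum_sub_distrib]

/-- The Poincaré-type inequality of the data term on `H¹₀`. -/
theorem norm_sq_le (hΩ : IsOpen Ω) {v : L2 Ω} (hv : v ∈ H10 Ω) :
    ‖v‖ ^ 2 ≤ D.mismatch * (D.radius ^ 2 * D.overlap / Real.pi ^ 2 *
      (∑ i, ‖weakPartial i v‖ ^ 2) + D.dataForm v v) := by
  obtain ⟨w, φ, hφ, hwφ, hw, hw'⟩ := exists_seq_tendsto_of_mem_H10 hΩ hv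
  have hform : ∀ v, D.dataForm v v = ∑ i, volume.real (D.B i) * D.averageCLM i v ^ 2 := fun v => by
    rw [D.dataForm_apply]
    refine Finset.sum_congr rfl fun i _ => ?_
    change _ * D.averageCLM i v * D.averageCLM i v = _
    ring
  simp only [hform]
  refine le_of_tendsto_of_tendsto (hw.norm.pow 2) (((tendsto_finsetSum _ fun i _ =>
    (hw' i).norm.pow 2).const_mul _ |>.add (tendsto_finsetSum _ fun i _ =>
    ((((D.averageCLM i).continuous.tendsto v).comp hw).pow 2).const_mul _)).const_mul _)
    (Filter.Eventually.of_forall fun n => ?_)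
  have h1 := D.setIntegral_sq_le hΩ (hφ n)
  have e1 : ∑ i, ‖weakPartial i (w n)‖ ^ 2 = ∫ x in Ω, ‖fderiv ℝ (φ n) x‖ ^ 2 := by
    simp only [norm_sq_eq_sum_sq_apply_single]
    rw [integral_finsetSum]
    · exact Finset.sum_congr rfl fun i _ =>
        norm_sq_eq_setIntegral ((hφ n).weakPartial_ae_eq hΩ (hwφ n) i)
    · intro i _
      have hc : Continuous fun x => fderiv ℝ (φ n) x (EuclideanSpace.single i 1) ^ 2 :=
        ((hφ n).continuous_partial i).pow 2
      have hs : HasCompactSupport fun x => fderiv ℝ (φ n) x (EuclideanSpace.single i 1) ^ 2 :=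
        ((hφ n).hasCompactSupport_partial i).comp_left (g := fun y : ℝ => y ^ 2) (by simp)
      exact (hc.integrable_of_hasCompactSupport hs).restrict
  have e2 : ∀ i, D.averageCLM i (w n) = ⨍ x in D.B i, φ n x := fun i => by
    change ⨍ x in D.B i, w n x = _
    rw [setAverage_eq, setAverage_eq,
      integral_congr_ae (ae_restrict_of_ae_restrict_of_subset (D.B_subset i) (hwφ n))]
  simp only [Function.comp_apply]
  rw [e1, norm_sq_eq_setIntegral (hwφ n)]
  simp only [e2]
  exact h1

end DataSets

/-! ### The error estimate -/

theorem mainTheorem5 {d m : ℕ} (Ω : Set (EuclideanSpace ℝ (Fin d))) (hΩ : IsOpen Ω)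
    (hΩb : Bornology.IsBounded Ω) (D : DataSets Ω m)
    (V : Submodule ℝ (L2 Ω)) (hV : (V : Set (L2 Ω)) ⊆ H10 Ω)
    (u : L2 Ω) (huV : u ∈ V) (huH2 : u ∈ H2 Ω)
    (β : Fin m → ℝ) (δ θ : ℝ) (hδ : 0 < δ) (hθ : θ ∈ Set.Ioc (0 : ℝ) 1)
    (hδθ : δ ∈ Set.Icc (θ * (D.radius ^ 2 * D.overlap / Real.pi ^ 2))
      (θ⁻¹ * (D.radius ^ 2 * D.overlap / Real.pi ^ 2)))
    (uReg : L2 Ω)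
    (huReg : D.IsRegularizedSolution V (fun _ => 1) (fun _ => 0) 0 δ β uReg) :
    ‖uReg - u‖ ≤
      D.mismatch * θ⁻¹ * (D.radius ^ 2 * D.overlap / Real.pi ^ 2) * ‖weakLaplacian u‖
        + D.mismatch * θ⁻¹ * ‖D.dataFunctional β - D.dataForm u‖ := by
  set P := D.radius ^ 2 * D.overlap / Real.pi ^ 2 with hP
  have hP0 : 0 ≤ P := by positivity
  obtain ⟨hθ0, hθ1⟩ := hθ
  have hθinv : 1 ≤ θ⁻¹ := (one_le_inv₀ hθ0).2 hθ1
  have hη := D.mismatch_nonneg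
  set e := uReg - u with he
  have heV : e ∈ V := V.sub_mem huReg.1 huV
  have heq := huReg.2 e heV
  set N := ‖D.dataFunctional β - D.dataForm u‖ with hN
  set G := ∑ i, ‖weakPartial i e‖ ^ 2 with hG
  have hG0 : 0 ≤ G := Finset.sum_nonneg fun i _ => sq_nonneg _
  -- The error equation, tested with the error itself.
  have henergy : G + δ⁻¹ * D.dataForm e e = inner ℝ (weakLaplacian u) e
      + δ⁻¹ * (D.dataFunctional β - D.dataForm u) e := by
    have h1 : ∑ i, inner ℝ (weakPartial i uReg) (weakPartial i e)
        = G + ∑ i, inner ℝ (weakPartial i u) (weakPartial i e) := by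
      rw [hG, ← Finset.sum_add_distrib]
      refine Finset.sum_congr rfl fun i _ => ?_
      rw [← real_inner_self_eq_norm_sq, ← inner_add_left]
      congr 1
      rw [he, weakPartial_sub hΩ i (hV huReg.1).1 (hV huV).1, sub_add_cancel]
    rw [pdeForm_one_zero, pdeLoad_zero, h1,
      sum_inner_weakPartial_eq_neg_inner_weakLaplacian hΩ huH2 (hV heV)] at heq
    have h2 : D.dataForm e e = D.dataForm uReg e - D.dataForm u e := by
      conv_lhs => rw [he, D.dataForm_sub]
      rfl
    rw [h2, sub_apply]
    linarith
  have hupper : G + δ⁻¹ * D.dataForm e e ≤ (‖weakLaplacian u‖ + δ⁻¹ * N) * ‖e‖ := by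
    rw [henergy, add_mul, mul_assoc]
    refine add_le_add (real_inner_le_norm _ _) (mul_le_mul_of_nonneg_left ?_ (by positivity))
    exact (le_abs_self _).trans ((D.dataFunctional β - D.dataForm u).le_opNorm e)
  have hb0 : 0 ≤ D.dataForm e e := by
    rw [D.dataForm_apply]
    refine Finset.sum_nonneg fun i _ => ?_
    rw [mul_assoc]
    exact mul_nonneg measureReal_nonneg (mul_self_nonneg _)
  -- Both terms of the Poincaré-type inequality are bounded by `μ` times those of the energy.
  set μ := max P δ with hμ
  have hμ0 : 0 < μ := lt_max_of_lt_right hδ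
  have hμP : μ ≤ θ⁻¹ * P := max_le (le_mul_of_one_le_left hP0 hθinv) hδθ.2
  have hμδ : μ * δ⁻¹ ≤ θ⁻¹ := by
    rw [← div_eq_mul_inv, div_le_iff₀ hδ]
    refine max_le ?_ (le_mul_of_one_le_left hδ.le hθinv)
    have := mul_le_mul_of_nonneg_left hδθ.1 (inv_nonneg.2 hθ0.le)
    rwa [inv_mul_cancel_left₀ hθ0.ne'] at this
  have hsq : ‖e‖ ^ 2 ≤ (D.mismatch * μ * (‖weakLaplacian u‖ + δ⁻¹ * N)) * ‖e‖ := by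
    calc ‖e‖ ^ 2 ≤ D.mismatch * (P * G + D.dataForm e e) := D.norm_sq_le hΩ (hV heV)
      _ ≤ D.mismatch * (μ * (G + δ⁻¹ * D.dataForm e e)) := by
          refine mul_le_mul_of_nonneg_left ?_ hη
          have h1 : P * G ≤ μ * G := mul_le_mul_of_nonneg_right (le_max_left _ _) hG0
          have h2 : δ * (δ⁻¹ * D.dataForm e e) ≤ μ * (δ⁻¹ * D.dataForm e e) :=
            mul_le_mul_of_nonneg_right (le_max_right _ _) (by positivity)
          rw [mul_inv_cancel_left₀ hδ.ne'] at h2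
          linarith
      _ ≤ D.mismatch * (μ * ((‖weakLaplacian u‖ + δ⁻¹ * N) * ‖e‖)) := by gcongr
      _ = _ := by ring
  have hle : ‖e‖ ≤ D.mismatch * μ * (‖weakLaplacian u‖ + δ⁻¹ * N) := by
    rcases (norm_nonneg e).eq_or_lt with h0 | h0
    · rw [← h0]; positivity
    · rw [pow_two] at hsq
      exact le_of_mul_le_mul_right hsq h0
  calc ‖e‖ ≤ D.mismatch * μ * (‖weakLaplacian u‖ + δ⁻¹ * N) := hle
    _ = D.mismatch * (μ * ‖weakLaplacian u‖ + μ * δ⁻¹ * N) := by ring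
    _ ≤ D.mismatch * (θ⁻¹ * P * ‖weakLaplacian u‖ + θ⁻¹ * N) := by gcongr
    _ = _ := by ring
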